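/- Let $d \ge 1$. A framework in $\mathbb{R}^d$ is a pair $(G,p)$ of a finite simple graph $G=(V,E)$ and a map $p : V \to \mathbb{R}^d$. Frameworks $(G,p)$ and $(G,q)$ are equivalent if $|q_i-q_j| = |p_i-p_j|$ for every edge $ij\in E$, and congruent if $q = g\circ p$ for an isometry $g$ of $\mathbb{R}^d$ (reflections allowed). $(G,p)$ is generic if the $d|V|$ coordinates of $p$ are algebraically independent over $\mathbb{Q}$; globally rigid if every equivalent framework is congruent to it; locally rigid if every equivalent framework sufficiently close to it is congruent to it; infinitesimally rigid if every $v : V\to\mathbb{R}^d$ with $\langle p_i-p_j, v_i-v_j\rangle=0$ for all edges $ij$ has the form $v_i = Ap_i+b$ with $A$ a skew-symmetric matrix and $b\in\mathbb{R}^d$; and isostatic if it is locally rigid and its edge constraints are independent, that is, the only symmetric weights $\omega_{ij}$ vanishing off the edges with $\sum_j \omega_{ij}(p_i-p_j)=0$ for all $i$ are $\omega=0$. **Theorem.** Let $(G,p)$ be a generic isostatic framework in $\mathbb{R}^d$ with at least $d+2$ vertices. Then: 1. $(G,p)$ is not globally rigid. 2. The number of congruence classes of frameworks equivalent to $(G,p)$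 (the class of $(G,p)$ itself included) is finite and even. 3. Every framework equivalent to $(G,p)$ is locally rigid and infinitesimally rigid, and it is congruent to a generic framework (so the number in 2 is also the number of equivalent generic frameworks up to congruence). 4. Every generic framework $(G,q)$ in $\mathbb{R}^d$ with the same graph $G$ is locally rigid. -/

import Mathlib

namespace Framework

/-- A configuration: an assignment of a point of Euclidean `d`-space to every vertex.
A framework is a graph `G` on `V` together with a configuration. -/
abbrev Configuration (V : Type*) (d : ℕ) := V → EuclideanSpace ℝ (Fin d)

/-- Two configurations are congruent if a rigid motion (an isometry of Euclidean space,
reflections included) carries one to the other. -/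
def IsCongruent {V : Type*} {d : ℕ} (p q : Configuration V d) : Prop :=
  ∃ g : EuclideanSpace ℝ (Fin d) ≃ᵃⁱ[ℝ] EuclideanSpace ℝ (Fin d), ∀ i, q i = g (p i)

/-- Congruence as an equivalence relation on configurations. -/
def congruence (V : Type*) (d : ℕ) : Setoid (Configuration V d) where
  r := IsCongruent
  iseqv :=
    { refl := fun _ => ⟨AffineIsometryEquiv.refl ℝ _, fun _ => rfl⟩
      symm := fun ⟨g, hg⟩ => ⟨g.symm, fun i => by rw [hg i, g.symm_apply_apply]⟩
      trans := fun ⟨g, hg⟩ ⟨h, hh⟩ => ⟨g.trans h, fun i => by rw [hh i, hg i]; rfl⟩ }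

/-- `(G, p)` and `(G, q)` are equivalent if every edge has the same length in both. -/
def IsEquivalent {V : Type*} {d : ℕ} (G : SimpleGraph V) (p q : Configuration V d) : Prop :=
  ∀ i j, G.Adj i j → dist (q i) (q j) = dist (p i) (p j)

/-- The congruence classes of the frameworks equivalent to `(G, p)`. -/
def realizations {V : Type*} {d : ℕ} (G : SimpleGraph V) (p : Configuration V d) :
    Set (Quotient (congruence V d)) :=
  Quotient.mk (congruence V d) '' {q | IsEquivalent G p q}

/-- The coordinates of all the points are algebraically independent over `ℚ`. -/
def IsGeneric {V : Type*} {d : ℕ} (p : Configuration V d) : Prop :=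
  AlgebraicIndependent ℚ (fun x : V × Fin d => p x.1 x.2)

/-- Every equivalent framework is congruent to `(G, p)`. -/
def IsGloballyRigid {V : Type*} {d : ℕ} (G : SimpleGraph V) (p : Configuration V d) : Prop :=
  ∀ q : Configuration V d, IsEquivalent G p q → IsCongruent p q

/-- Every equivalent framework that is close enough to `(G, p)` is congruent to it. -/
def IsLocallyRigid {V : Type*} {d : ℕ} (G : SimpleGraph V) (p : Configuration V d) : Prop :=
  ∃ ε > 0, ∀ q : Configuration V d,
    (∀ i, dist (q i) (p i) < ε) → IsEquivalent G p q → IsCongruent p q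

/-- Velocities that preserve all edge lengths to first order. -/
def IsInfinitesimalFlex {V : Type*} {d : ℕ} (G : SimpleGraph V) (p v : Configuration V d) :
    Prop :=
  ∀ i j, G.Adj i j → inner ℝ (p i - p j) (v i - v j) = 0

/-- Velocities induced by an infinitesimal rigid motion `x ↦ A x + b` with `A` skew. -/
def IsTrivialFlex {V : Type*} {d : ℕ} (p v : Configuration V d) : Prop :=
  ∃ (A : EuclideanSpace ℝ (Fin d) →ₗ[ℝ] EuclideanSpace ℝ (Fin d))
    (b : EuclideanSpace ℝ (Fin d)),
    (∀ x y, inner ℝ (A x) y = -inner ℝ x (A y)) ∧ ∀ i, v i = A (p i) + b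

/-- Every infinitesimal flex is trivial. -/
def IsInfinitesimallyRigid {V : Type*} {d : ℕ} (G : SimpleGraph V) (p : Configuration V d) :
    Prop :=
  ∀ v : Configuration V d, IsInfinitesimalFlex G p v → IsTrivialFlex p v

/-- A self-stress: symmetric edge weights (zero off the edges) in equilibrium at every vertex.
These are the linear relations between the rows of the rigidity matrix. -/
def IsSelfStress {V : Type*} [Fintype V] {d : ℕ} (G : SimpleGraph V) (p : Configuration V d)
    (ω : V → V → ℝ) : Prop :=
  (∀ i j, ω i j = ω j i) ∧ (∀ i j, ¬ G.Adj i j → ω i j = 0) ∧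
    ∀ i, ∑ j, ω i j • (p i - p j) = 0

/-- The length constraints of the edges are independent: there is no nonzero self-stress. -/
def IsIndependent {V : Type*} [Fintype V] {d : ℕ} (G : SimpleGraph V) (p : Configuration V d) :
    Prop :=
  ∀ ω : V → V → ℝ, IsSelfStress G p ω → ∀ i j, ω i j = 0

/-- Isostatic: rigid (realizations are locally unique up to congruence), by independent
constraints, so that none of them can be spared. -/
def IsIsostatic {V : Type*} [Fintype V] {d : ℕ} (G : SimpleGraph V) (p : Configuration V d) :
    Prop :=
  IsLocallyRigid G p ∧ IsIndependent G p

end Framework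

/-! Modulo congruence a configuration can be pinned: vertex number k, counted from 0, lies in the
span of the first k basis vectors. For a generic isostatic framework the squared edge lengths, as
functions of the free coordinates, form a map f between spaces of equal dimension
(`IsIsostatic.card_eq`), and the lengths `a` of the given framework are algebraically independent.

Independence enters only through derivations: a finite family of reals is independent over ℚ iff
derivations of ℝ take arbitrary values on it (`AlgebraicIndependent.exists_derivation`,
`algebraicIndependent_of_derivations`). A derivation applied to the coordinates of a configuration
is a velocity, and by the product rule it changes the lengths as a velocity does
(`derivation_distForm`). Hence df is onto, so bijective, at every point of the fibre f = a, not only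
at the given one. This yields infinitesimal rigidity; compactness of the fibre then gives finiteness
and local rigidity. Genericity of the other realizations comes from transporting derivations between
two points of the fibre (`exists_isCongruent_isGeneric`).

For the parity, free one edge E₀: let K consist of the pinned configurations with all other lengths
as in `a` and the length of E₀ at most its value in `a`. The other lengths are still independent, so
K lies on a regular curve; K is compact, and each point of the fibre is an end of an arc of K whose
other end is again in the fibre (`isArcEnd_of_submersion`). The reflection σ in the last coordinate
has no fixed point on K, because at most one free coordinate of a point of K vanishes while at least
d + 2 vertices leave two in the last direction (`reflect_ne_self`). Were σ to swap the ends of an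
arc, it would fix a point of it. So passing to the other end is a fixed-point-free involution of the
fibre modulo σ (`even_ncard_of_isArcEnd`). With the signs of the diagonal coordinates other than the
last taken positive, that quotient is the set of congruence classes; these signs are constant along
arcs because the coordinates never vanish on K (`diagCoord_ne_zero`). An even number is not 1, which
rules out global rigidity. -/

/-! ### Algebraic independence over ℚ via derivations of ℝ. -/

section Derivations

open MvPolynomial TensorProduct

/-- A derivation of a ring extends along a formally étale algebra. -/
theorem exists_derivation_extension (S L : Type*) [CommRing S] [CommRing L] [Algebra ℚ S]
    [Algebra ℚ L] [Algebra S L] [IsScalarTower ℚ S L] [Algebra.FormallyEtale S L]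
    (d : Derivation ℚ S L) : ∃ D : Derivation ℚ L L, ∀ s, D (algebraMap S L s) = d s := by
  let φ : L ⊗[S] Ω[S⁄ℚ] →ₗ[L] L := (LinearMap.liftBaseChange L d.liftKaehlerDifferential)
  let e := KaehlerDifferential.tensorKaehlerEquivOfFormallyEtale ℚ S L
  refine ⟨(φ ∘ₗ e.symm.toLinearMap).compDer (KaehlerDifferential.D ℚ L), fun s => ?_⟩
  have := KaehlerDifferential.tensorKaehlerEquivOfFormallyEtale_symm_D_algebraMap ℚ S L s
  simp [e, φ, this]

/-- Extend the family to a transcendence basis B. A derivation of ℚ[B] may be prescribed on the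
variables, and it extends to ℝ because ℝ is algebraic, hence in characteristic zero separable, over
ℚ(B). -/
theorem AlgebraicIndependent.exists_derivation {ι : Type*} {y : ι → ℝ}
    (hy : AlgebraicIndependent ℚ y) (c : ι → ℝ) :
    ∃ D : Derivation ℚ ℝ ℝ, ∀ i, D (y i) = c i := by
  obtain ⟨B, hB, hB'⟩ := exists_isTranscendenceBasis_superset (R := ℚ) hy.to_subtype_range
  have hinj : Function.Injective y := hy.injective
  let S := MvPolynomial B ℚ
  let _ : Algebra S ℝ := (aeval ((↑) : B → ℝ) : S →ₐ[ℚ] ℝ).toAlgebra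
  have halg : ∀ s : S, algebraMap S ℝ s = aeval ((↑) : B → ℝ) s := fun _ => rfl
  have : IsScalarTower ℚ S ℝ := IsScalarTower.of_algebraMap_eq' (by ext; simp)
  have : FaithfulSMul S ℝ := (faithfulSMul_iff_algebraMap_injective S ℝ).2 hB'.1
  let K := FractionRing S
  let _ : Algebra K ℝ := FractionRing.liftAlgebra S ℝ
  have : IsScalarTower S K ℝ := FractionRing.isScalarTower_liftAlgebra S ℝ
  have : Algebra.IsAlgebraic S ℝ := by
    constructor
    intro z
    have h := hB'.isAlgebraic.isAlgebraic z
    obtain ⟨P, hP0, hP⟩ := h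
    have hcomp : (algebraMap S ℝ).comp (hB'.1.aevalEquiv.symm : _ →+* S) =
        algebraMap (Algebra.adjoin ℚ (Set.range ((↑) : B → ℝ))) ℝ := by
      ext w
      obtain ⟨s, rfl⟩ := hB'.1.aevalEquiv.surjective w
      simp [halg]
    refine ⟨P.map (hB'.1.aevalEquiv.symm : _ →+* S),
      (Polynomial.map_ne_zero_iff hB'.1.aevalEquiv.symm.injective).2 hP0, ?_⟩
    rw [Polynomial.aeval_def, Polynomial.eval₂_map, hcomp, ← Polynomial.aeval_def, hP]
  have : Algebra.IsAlgebraic K ℝ := (IsFractionRing.comap_isAlgebraic_iff (A := S)).1 inferInstance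
  have : Algebra.FormallyEtale S K := Algebra.FormallyEtale.of_isLocalization (nonZeroDivisors S)
  have : Algebra.FormallyEtale K ℝ := Algebra.FormallyEtale.of_isSeparable K ℝ
  have : Algebra.FormallyEtale S ℝ := Algebra.FormallyEtale.comp S K ℝ
  let c' : B → ℝ := fun b => Function.extend y c 0 b
  obtain ⟨D, hD⟩ := exists_derivation_extension S ℝ (MvPolynomial.mkDerivation ℚ c')
  refine ⟨D, fun i => ?_⟩
  have := hD (X ⟨y i, hB ⟨i, rfl⟩⟩)
  rw [halg, aeval_X, mkDerivation_X] at this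
  rw [this]
  exact hinj.extend_apply c 0 i

theorem Derivation.apply_aeval {ι : Type*} [Fintype ι] (D : Derivation ℚ ℝ ℝ) (y : ι → ℝ)
    (P : MvPolynomial ι ℚ) :
    D (aeval y P) = ∑ i, aeval y (pderiv i P) * D (y i) := by
  classical
  induction P using MvPolynomial.induction_on with
  | C a =>
    rw [aeval_C, D.map_algebraMap]
    simp
  | add P Q hP hQ => simp [hP, hQ, add_mul, Finset.sum_add_distrib]
  | mul_X P j hP =>
    simp only [map_mul, aeval_X, Derivation.leibniz, hP, smul_eq_mul, map_add, pderiv_X,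
      add_mul, Finset.sum_add_distrib, Finset.mul_sum]
    congr 1
    · rw [Finset.sum_eq_single j]
      · simp
      · intro b _ hb; simp [hb]
      · simp
    · exact Finset.sum_congr rfl fun i _ => by ring

theorem MvPolynomial.totalDegree_pderiv_lt {ι : Type*} (P : MvPolynomial ι ℚ) (i : ι)
    (h : pderiv i P ≠ 0) : (pderiv i P).totalDegree < P.totalDegree := by
  classical
  obtain ⟨m, hm, hmd⟩ := Finset.exists_mem_eq_sup (pderiv i P).support
    (support_nonempty.2 h) (fun m => m.sum fun _ e => e)
  rw [mem_support_iff, coeff_pderiv] at hm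
  have hm' : m + Finsupp.single i 1 ∈ P.support :=
    mem_support_iff.2 (left_ne_zero_of_mul hm)
  have := le_totalDegree hm'
  rw [Finsupp.sum_add_index' (fun _ => rfl) (fun _ _ _ => rfl),
    Finsupp.sum_single_index rfl] at this
  rw [totalDegree, hmd]
  omega

/-- Applying to a relation P(y) = 0 a derivation that is 1 on one member and 0 on the others shows
that the partial derivatives of P are relations too. They have smaller degree, so by induction they
vanish identically, and P is constant. -/
theorem algebraicIndependent_of_derivations {ι : Type*} [Fintype ι] {y : ι → ℝ}
    (h : ∀ c : ι → ℝ, ∃ D : Derivation ℚ ℝ ℝ, ∀ i, D (y i) = c i) :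
    AlgebraicIndependent ℚ y := by
  classical
  rw [algebraicIndependent_iff]
  suffices ∀ n, ∀ P : MvPolynomial ι ℚ, P.totalDegree < n → aeval y P = 0 → P = 0 from
    fun P hP => this _ P (Nat.lt_succ_self _) hP
  intro n
  induction n with
  | zero => simp
  | succ n ih =>
    intro P hn hP
    have hd : ∀ i, pderiv i P = 0 := by
      intro i
      by_contra hne
      refine hne (ih _ (by have := P.totalDegree_pderiv_lt i hne; omega) ?_)
      obtain ⟨D, hD⟩ := h (Pi.single i 1)
      have := D.apply_aeval y P
      simpa [hP, hD, Pi.single_apply] using this.symm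
    have : P = C (coeff 0 P) := by
      ext m
      rw [coeff_C]
      split_ifs with hm
      · rw [hm]
      · obtain ⟨i, hi⟩ := Finsupp.ne_iff.1 (Ne.symm hm)
        have h1 := congrArg (coeff (m - Finsupp.single i 1)) (hd i)
        rw [coeff_pderiv, tsub_add_cancel_of_le
          (Finsupp.single_le_iff.2 (Nat.one_le_iff_ne_zero.2 hi)), coeff_zero] at h1
        exact (mul_eq_zero.1 h1).resolve_right (by positivity)
    rw [this] at hP ⊢
    simpa using hP

end Derivations

/-! ### Trajectories of a vector field that sweep out arcs. -/

section Arcs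

open Set Filter Topology

theorem HasDerivAt.eventually_lt_right {φ : ℝ → ℝ} {m t : ℝ} (h : HasDerivAt φ m t) (hm : 0 < m) :
    ∃ ε > 0, ∀ s, t < s → s < t + ε → φ t < φ s := by
  have h1 := (hasDerivAt_iff_tendsto_slope.1 h).eventually (lt_mem_nhds hm)
  rw [eventually_nhdsWithin_iff, Metric.eventually_nhds_iff] at h1
  obtain ⟨ε, hε, H⟩ := h1
  refine ⟨ε, hε, fun s hs hs' => ?_⟩
  have := H (y := s) (by rw [Real.dist_eq, abs_of_pos (by linarith)]; linarith) (ne_of_gt hs)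
  rw [slope_def_field, div_pos_iff_of_pos_right (by linarith)] at this
  linarith

theorem HasDerivAt.eventually_lt_left {φ : ℝ → ℝ} {m t : ℝ} (h : HasDerivAt φ m t) (hm : 0 < m) :
    ∃ ε > 0, ∀ s, t - ε < s → s < t → φ s < φ t := by
  have h1 := (hasDerivAt_iff_tendsto_slope.1 h).eventually (lt_mem_nhds hm)
  rw [eventually_nhdsWithin_iff, Metric.eventually_nhds_iff] at h1
  obtain ⟨ε, hε, H⟩ := h1
  refine ⟨ε, hε, fun s hs hs' => ?_⟩
  have := H (y := s) (by rw [Real.dist_eq, abs_of_neg (by linarith)]; linarith) (ne_of_lt hs')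
  rw [slope_def_field, div_pos_iff] at this
  rcases this with h | h <;> linarith [h.1, h.2]

variable {E : Type*} [NormedAddCommGroup E] [NormedSpace ℝ E]

/-- A curve defined for all times that solves the autonomous equation `γ' = Y γ`. -/
def IsTrajectory (Y : E → E) (γ : ℝ → E) : Prop := ∀ t, HasDerivAt γ (Y (γ t)) t

namespace IsTrajectory

variable {Y : E → E} {γ η : ℝ → E}

theorem continuous (h : IsTrajectory Y γ) : Continuous γ :=
  continuous_iff_continuousAt.2 fun t => (h t).continuousAt

theorem shift (h : IsTrajectory Y γ) (s : ℝ) : IsTrajectory Y (fun t => γ (s + t)) := fun t =>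
  (h (s + t)).comp_const_add s t

theorem reverse (h : IsTrajectory Y γ) : IsTrajectory (fun x => -Y x) (fun t => γ (-t)) := by
  intro t
  simpa [Function.comp_def] using (h (-t)).scomp t (hasDerivAt_neg t)

theorem eq_of_eq {K : NNReal} (hY : LipschitzWith K Y) (h : IsTrajectory Y γ)
    (h' : IsTrajectory Y η) {s t : ℝ} (heq : γ s = η t) (r : ℝ) : γ (s + r) = η (t + r) := by
  have := ODE_solution_unique_univ (v := fun _ => Y) (s := fun _ => univ) (t₀ := 0)
    (fun _ => hY.lipschitzOnWith) (fun t => ⟨h.shift s t, trivial⟩)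
    (fun r => ⟨h'.shift t r, trivial⟩) (by simpa using heq)
  exact congrFun this r

end IsTrajectory

theorem exists_isTrajectory [CompleteSpace E] {Y : E → E} {K L : NNReal} (hY : LipschitzWith K Y)
    (hL : ∀ x, ‖Y x‖ ≤ L) (x : E) : ∃ γ, γ 0 = x ∧ IsTrajectory Y γ := by
  have key : ∀ a : ℝ, 0 < a → ∃ α : ℝ → E, α 0 = x ∧ ∀ t ∈ Ioo (-a) a,
      HasDerivAt α (Y (α t)) t := by
    intro a ha
    have hpl : IsPicardLindelof (fun _ => Y) (tmin := -a) (tmax := a)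
        ⟨0, by constructor <;> linarith⟩ x (L * ⟨a, ha.le⟩) 0 L K :=
      .of_time_independent (fun x _ => hL x) hY.lipschitzOnWith (by simp; exact le_of_eq rfl)
    obtain ⟨α, h0, hα⟩ := hpl.exists_eq_forall_mem_Icc_hasDerivWithinAt₀
    exact ⟨α, h0, fun t ht => (hα t (Ioo_subset_Icc_self ht)).hasDerivAt (Icc_mem_nhds ht.1 ht.2)⟩
  choose α h0 hα using key
  have hpos : ∀ t : ℝ, 0 < |t| + 1 := fun t => by positivity
  have hagree : ∀ a b (ha : 0 < a) (hb : 0 < b), a ≤ b → EqOn (α a ha) (α b hb) (Ioo (-a) a) := by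
    intro a b ha hb hab
    refine ODE_solution_unique_of_mem_Ioo (v := fun _ => Y) (s := fun _ => univ) (t₀ := 0) (K := K)
      (fun _ _ => hY.lipschitzOnWith) ⟨by linarith, ha⟩ (fun t ht => ⟨hα a ha t ht, trivial⟩)
      (fun t ht => ⟨hα b hb t ⟨by linarith [ht.1], by linarith [ht.2]⟩, trivial⟩)
      ((h0 _ _).trans (h0 _ _).symm)
  -- The time t is read off a solution on an interval containing it; near t all these agree with the
  -- one on the interval of radius |t| + 2.
  refine ⟨fun t => α (|t| + 1) (hpos t) t, h0 _ _, fun t => ?_⟩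
  have ht2 : 0 < |t| + 2 := by positivity
  have hmem : t ∈ Ioo (-(|t| + 2)) (|t| + 2) :=
    ⟨by linarith [neg_abs_le t], by linarith [le_abs_self t]⟩
  have hev : (fun t => α (|t| + 1) (hpos t) t) =ᶠ[𝓝 t] α (|t| + 2) ht2 := by
    have : ∀ᶠ s in 𝓝 t, |s| < |t| + 1 :=
      (continuous_abs.tendsto t).eventually (gt_mem_nhds (by linarith))
    filter_upwards [this] with s hs
    exact hagree _ _ (hpos s) ht2 (by linarith)
      ⟨by linarith [neg_abs_le s], by linarith [le_abs_self s]⟩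
  have := (hα (|t| + 2) ht2 t hmem).congr_of_eventuallyEq hev
  rwa [← hev.eq_of_nhds] at this

/-- A point of `K` is an end of an arc if its component in `K` is an embedded interval starting
at the point, which meets the level set `h = c` exactly at its two ends. -/
def IsArcEnd (K : Set E) (h : E → ℝ) (c : ℝ) (x : E) : Prop :=
  ∃ T > 0, ∃ γ : ℝ → E, ContinuousOn γ (Icc 0 T) ∧ InjOn γ (Icc 0 T) ∧ γ 0 = x ∧
    γ '' Icc 0 T = connectedComponentIn K x ∧
    ∀ t ∈ Icc 0 T, h (γ t) = c ↔ t = 0 ∨ t = T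

/-- A is connected and relatively clopen in K. -/
theorem eq_connectedComponentIn_of_isOpen_inter {X : Type*} [TopologicalSpace X] {K A U : Set X}
    {x : X} (hx : x ∈ A) (hA : IsPreconnected A) (hAK : A ⊆ K) (hcl : IsClosed A) (hU : IsOpen U)
    (hAU : A ⊆ U) (hUA : U ∩ K ⊆ A) : A = connectedComponentIn K x := by
  refine Subset.antisymm (hA.subset_connectedComponentIn hx hAK) ?_
  have hpre := isPreconnected_connectedComponentIn (F := K) (x := x)
  have hsub := connectedComponentIn_subset K x
  have := isPreconnected_iff_subset_of_disjoint.1 hpre U Aᶜ hU hcl.isOpen_compl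
    (fun z hz => by by_cases h : z ∈ A; exacts [Or.inl (hAU h), Or.inr h])
    (by
      ext z
      simp only [mem_inter_iff, mem_compl_iff, mem_empty_iff_false, iff_false]
      rintro ⟨hz, hzU, hzA⟩
      exact hzA (hUA ⟨hzU, hsub hz⟩))
  rcases this with h | h
  · exact fun z hz => hUA ⟨h hz, hsub hz⟩
  · exact absurd hx (h (mem_connectedComponentIn (hAK hx)))

/-- A trajectory entering `{h < c}` leaves it again, and sweeps out a component on its way. -/
theorem isArcEnd_of_neg [CompleteSpace E] {Y : E → E} {κ L : NNReal} (hY : LipschitzWith κ Y)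
    (hL : ∀ x, ‖Y x‖ ≤ L) {M : Set E} {h g : E → ℝ} {c : ℝ}
    (hM : ∀ γ, IsTrajectory Y γ → γ 0 ∈ M → ∀ t, γ t ∈ M)
    (hg : ∀ γ, IsTrajectory Y γ → ∀ t, HasDerivAt (fun s => h (γ s)) (g (γ t)) t)
    (hK : IsCompact {x ∈ M | h x ≤ c})
    (hbox : ∀ γ, IsTrajectory Y γ → γ 0 ∈ M → h (γ 0) ≤ c → ∀ ε > 0,
      ∃ W ∈ 𝓝 (γ 0), ∀ z ∈ W, z ∈ M → ∃ s, |s| < ε ∧ z = γ s)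
    (hc : ∀ x ∈ M, h x = c → g x ≠ 0) {x : E} (hxM : x ∈ M) (hxc : h x = c) (hx : g x < 0) :
    IsArcEnd {x ∈ M | h x ≤ c} h c x := by
  obtain ⟨γ, h0, hγ⟩ := exists_isTrajectory hY hL x
  have hγM : ∀ t, γ t ∈ M := hM γ hγ (h0 ▸ hxM)
  have hcont : Continuous fun s => h (γ s) :=
    continuous_iff_continuousAt.2 fun t => (hg γ hγ t).continuousAt
  have hd0 := (hg γ hγ 0).neg
  rw [h0] at hd0
  obtain ⟨ε₁, hε₁, hr⟩ := hd0.eventually_lt_right (by linarith)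
  obtain ⟨ε₂, hε₂, hl⟩ := hd0.eventually_lt_left (by linarith)
  simp only [Pi.neg_apply, h0, hxc, neg_lt_neg_iff, zero_add, zero_sub] at hr hl
  -- below the level until the next crossing
  have hbelow : ∀ b, (∀ t, 0 < t → t < b → h (γ t) ≠ c) → ∀ t, 0 < t → t < b → h (γ t) < c := by
    intro b hb t ht htb
    by_contra! hge
    set s := min (ε₁ / 2) (t / 2)
    have hs : 0 < s := by positivity
    have hs1 : s < ε₁ := (min_le_left _ _).trans_lt (by linarith)
    have hst : s < t := (min_le_right _ _).trans_lt (by linarith)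
    obtain ⟨u, hu, hu'⟩ := intermediate_value_Icc hst.le hcont.continuousOn ⟨(hr s hs hs1).le, hge⟩
    exact hb u (hs.trans_le hu.1) (hu.2.trans_lt htb) hu'
  -- the trajectory returns
  have hret : ∃ t > 0, h (γ t) = c := by
    by_contra! hne
    have hlt : ∀ t, 0 < t → h (γ t) < c := fun t ht =>
      hbelow (t + 1) (fun s hs _ => hne s hs) t ht (by linarith)
    -- A trajectory that stays in the compact set accumulates at some y. Two of its points, at times
    -- at least 1 apart, lie on the piece of the trajectory of y with |time| < 1/4. By uniqueness γ
    -- is periodic with period greater than 1 - 1/2, so it comes back to x, on the level c.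
    obtain ⟨y, hyK, φ, hφ, hlim⟩ := hK.tendsto_subseq (x := fun n : ℕ => γ (n + 1))
      (fun n => ⟨hγM _, (hlt _ (by positivity)).le⟩)
    obtain ⟨η, hη0, hη⟩ := exists_isTrajectory hY hL y
    obtain ⟨W, hW, hWbox⟩ := hbox η hη (hη0 ▸ hyK.1) (hη0 ▸ hyK.2) (1 / 4) (by norm_num)
    rw [hη0] at hW
    obtain ⟨N, hN⟩ := eventually_atTop.1 (hlim.eventually hW)
    obtain ⟨s, hs, hse⟩ := hWbox _ (hN N le_rfl) (hγM _)
    obtain ⟨s', hs', hse'⟩ := hWbox _ (hN (N + 1) (Nat.le_succ N)) (hγM _)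
    simp only [Function.comp_apply] at hse hse'
    have hlt' : ((φ N : ℕ) : ℝ) + 1 ≤ φ (N + 1) := by exact_mod_cast hφ (Nat.lt_succ_self N)
    rw [abs_lt] at hs hs'
    have e1 := hγ.eq_of_eq hY hη hse (s' - s)
    rw [add_sub_cancel, ← hse'] at e1
    have e2 := hγ.eq_of_eq hY hγ e1 (-((φ N : ℝ) + 1 + (s' - s)))
    rw [add_neg_cancel, h0] at e2
    refine hne _ ?_ (e2 ▸ hxc)
    linarith
  obtain ⟨t₁, ht₁, ht₁c⟩ := hret
  -- first return
  have hZc : IsClosed {t | ε₁ ≤ t ∧ h (γ t) = c} :=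
    (isClosed_le continuous_const continuous_id).inter (isClosed_eq hcont continuous_const)
  have hZ1 : t₁ ∈ {t | ε₁ ≤ t ∧ h (γ t) = c} := by
    refine ⟨?_, ht₁c⟩
    by_contra! hlt
    exact (hr t₁ ht₁ hlt).ne ht₁c
  have hbdd : BddBelow {t | ε₁ ≤ t ∧ h (γ t) = c} := ⟨ε₁, fun t ht => ht.1⟩
  set T := sInf {t | ε₁ ≤ t ∧ h (γ t) = c} with hT
  obtain ⟨hTε, hTc⟩ : ε₁ ≤ T ∧ h (γ T) = c := hZc.csInf_mem ⟨_, hZ1⟩ hbdd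
  have hT0 : 0 < T := hε₁.trans_le hTε
  have hlt : ∀ t, 0 < t → t < T → h (γ t) < c := by
    refine hbelow T fun t ht htT htc => ?_
    rcases lt_or_ge t ε₁ with h1 | h1
    · exact (hr t ht h1).ne htc
    · exact (notMem_of_lt_csInf htT hbdd) ⟨h1, htc⟩
  -- With a negative derivative at T, h would exceed c just before T. The maximum with T / 2 keeps
  -- the test time positive.
  have hgT : 0 < g (γ T) := by
    refine lt_of_le_of_ne ?_ (hc _ (hγM T) hTc).symm
    by_contra! hneg
    obtain ⟨ε, hε, H⟩ := ((hg γ hγ T).neg).eventually_lt_left (by linarith)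
    have := H (max (T - ε / 2) (T / 2)) (lt_max_of_lt_left (by linarith))
      (max_lt (by linarith) (by linarith))
    have h2 := hlt (max (T - ε / 2) (T / 2)) (lt_max_of_lt_right (by linarith))
      (max_lt (by linarith) (by linarith))
    simp only [Pi.neg_apply, hTc] at this
    linarith
  have hTx : γ T ≠ x := fun he => by rw [he] at hgT; linarith
  obtain ⟨ε₃, hε₃, hr'⟩ := (hg γ hγ T).eventually_lt_right hgT
  simp only [hTc] at hr'
  have hle : ∀ t ∈ Icc 0 T, h (γ t) ≤ c := by
    intro t ht
    rcases ht.1.eq_or_lt with h1 | h1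
    · rw [← h1, h0, hxc]
    rcases ht.2.eq_or_lt with h2 | h2
    · rw [h2, hTc]
    exact (hlt t h1 h2).le
  have hAK : γ '' Icc 0 T ⊆ {x ∈ M | h x ≤ c} := by
    rintro _ ⟨t, ht, rfl⟩
    exact ⟨hγM t, hle t ht⟩
  -- The arc is relatively open in the sublevel set: nearby points of M lie on γ, and just before 0
  -- or just after T the curve is above the level c.
  have hopen : ∀ t ∈ Icc 0 T, ∃ W ∈ 𝓝 (γ t), ∀ z ∈ W, z ∈ {x ∈ M | h x ≤ c} →
      z ∈ γ '' Icc 0 T := by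
    intro t ht
    have hbox' := hbox (fun s => γ (t + s)) (hγ.shift t) (hγM _) (by simpa using hle t ht)
    simp only [add_zero] at hbox'
    rcases ht.1.eq_or_lt with h1 | h1
    · obtain ⟨W, hW, H⟩ := hbox' (min ε₂ T) (by positivity)
      refine ⟨W, hW, fun z hz hzK => ?_⟩
      obtain ⟨s, hs, rfl⟩ := H z hz hzK.1
      rw [abs_lt, ← h1] at *
      have hs1 := hs.1
      have := min_le_left ε₂ T
      have := min_le_right ε₂ T
      refine ⟨0 + s, ⟨?_, by linarith⟩, rfl⟩
      by_contra! hneg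
      have := hl (0 + s) (by linarith) (by linarith)
      linarith [hzK.2]
    rcases ht.2.eq_or_lt with h2 | h2
    · obtain ⟨W, hW, H⟩ := hbox' (min ε₃ T) (by positivity)
      refine ⟨W, hW, fun z hz hzK => ?_⟩
      obtain ⟨s, hs, rfl⟩ := H z hz hzK.1
      rw [abs_lt, h2] at *
      have := min_le_left ε₃ T
      have := min_le_right ε₃ T
      refine ⟨T + s, ⟨by linarith, ?_⟩, rfl⟩
      by_contra! hneg
      have := hr' (T + s) (by linarith) (by linarith)
      linarith [hzK.2]
    · obtain ⟨W, hW, H⟩ := hbox' (min t (T - t)) (lt_min h1 (by linarith))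
      refine ⟨W, hW, fun z hz hzK => ?_⟩
      obtain ⟨s, hs, rfl⟩ := H z hz hzK.1
      rw [abs_lt] at hs
      have := min_le_left t (T - t)
      have := min_le_right t (T - t)
      exact ⟨t + s, ⟨by linarith, by linarith⟩, rfl⟩
  refine ⟨T, hT0, γ, hγ.continuous.continuousOn, ?_, h0, ?_, ?_⟩
  -- A coincidence can be shifted back in time to γ (t - s) = x with 0 < t - s ≤ T. This is excluded
  -- by the level for t - s < T, and by the sign of g for t - s = T.
  · have : ∀ s ∈ Icc 0 T, ∀ t ∈ Icc 0 T, s < t → γ s ≠ γ t := by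
      intro s hs t ht hst he
      have e := hγ.eq_of_eq hY hγ he (-s)
      rw [add_neg_cancel, h0] at e
      rcases (show t + -s ≤ T by linarith [hs.1, ht.2]).eq_or_lt with h1 | h1
      · exact hTx (h1 ▸ e.symm)
      · have := hlt _ (by linarith) h1
        rw [← e] at this
        linarith
    intro s hs t ht he
    by_contra hne
    rcases lt_or_gt_of_ne hne with h1 | h1
    · exact this s hs t ht h1 he
    · exact this t ht s hs h1 he.symm
  · choose! W hW hWA using hopen
    refine eq_connectedComponentIn_of_isOpen_inter (U := ⋃ t ∈ Icc 0 T, interior (W t))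
      ⟨0, ⟨le_rfl, hT0.le⟩, h0⟩ (isPreconnected_Icc.image _ hγ.continuous.continuousOn) hAK
      (isCompact_Icc.image hγ.continuous).isClosed
      (isOpen_biUnion fun t _ => isOpen_interior) ?_ ?_
    · rintro _ ⟨t, ht, rfl⟩
      exact mem_biUnion ht (mem_interior_iff_mem_nhds.2 (hW t ht))
    · rintro z ⟨hz, hzK⟩
      obtain ⟨t, ht, hzt⟩ := mem_iUnion₂.1 hz
      exact hWA t ht z (interior_subset hzt) hzK
  · intro t ht
    constructor
    · intro htc
      by_contra! hne
      exact (hlt t (lt_of_le_of_ne ht.1 hne.1.symm) (lt_of_le_of_ne ht.2 hne.2)).ne htc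
    · rintro (rfl | rfl)
      · rw [h0, hxc]
      · exact hTc

theorem isArcEnd_of_trajectories [CompleteSpace E] {Y : E → E} {κ L : NNReal}
    (hY : LipschitzWith κ Y)
    (hL : ∀ x, ‖Y x‖ ≤ L) {M : Set E} {h g : E → ℝ} {c : ℝ}
    (hM : ∀ γ, IsTrajectory Y γ → γ 0 ∈ M → ∀ t, γ t ∈ M)
    (hg : ∀ γ, IsTrajectory Y γ → ∀ t, HasDerivAt (fun s => h (γ s)) (g (γ t)) t)
    (hK : IsCompact {x ∈ M | h x ≤ c})
    (hbox : ∀ γ, IsTrajectory Y γ → γ 0 ∈ M → h (γ 0) ≤ c → ∀ ε > 0,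
      ∃ W ∈ 𝓝 (γ 0), ∀ z ∈ W, z ∈ M → ∃ s, |s| < ε ∧ z = γ s)
    (hc : ∀ x ∈ M, h x = c → g x ≠ 0) {x : E} (hxM : x ∈ M) (hxc : h x = c) :
    IsArcEnd {x ∈ M | h x ≤ c} h c x := by
  rcases lt_or_gt_of_ne (hc x hxM hxc) with hx | hx
  · exact isArcEnd_of_neg hY hL hM hg hK hbox hc hxM hxc hx
  -- If the field points out of the sublevel set at x, run time backwards.
  have hrev : ∀ γ, IsTrajectory (fun x => -Y x) γ → IsTrajectory Y (fun t => γ (-t)) := by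
    intro γ hγ
    simpa using hγ.reverse
  refine isArcEnd_of_neg (Y := fun x => -Y x) (g := fun x => -g x) hY.neg (by simpa using hL)
    ?_ ?_ hK ?_ (fun x hx hxc => neg_ne_zero.2 (hc x hx hxc)) hxM hxc (neg_lt_zero.2 hx)
  · intro γ hγ h0 t
    simpa using hM _ (hrev γ hγ) (by simpa using h0) (-t)
  · intro γ hγ t
    simpa [Function.comp_def] using (hg _ (hrev γ hγ) (-t)).scomp t (hasDerivAt_neg t)
  · intro γ hγ h0 hle ε hε
    obtain ⟨W, hW, H⟩ := hbox _ (hrev γ hγ) (by simpa using h0) (by simpa using hle) ε hε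
    refine ⟨W, by simpa using hW, fun z hz hzM => ?_⟩
    obtain ⟨s, hs, rfl⟩ := H z hz hzM
    exact ⟨-s, by simpa using hs, rfl⟩

end Arcs

/-! ### Regular level curves as trajectories of the generalised cross product. -/

section LevelCurves

open Set Filter Topology
open scoped ContDiff

variable {ι : Type*} [Fintype ι] [DecidableEq ι]

theorem HasStrictFDerivAt.exists_injOn_of_injective {E : Type*} [NormedAddCommGroup E]
    [NormedSpace ℝ E] [FiniteDimensional ℝ E] {f : E → E} {f' : E →L[ℝ] E} {a : E}
    (hf : HasStrictFDerivAt f f' a) (hinj : Function.Injective f') : ∃ U ∈ 𝓝 a, InjOn f U := by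
  have := FiniteDimensional.complete ℝ E
  let e : E ≃L[ℝ] E := (LinearEquiv.ofInjectiveEndo (f' : E →ₗ[ℝ] E) hinj).toContinuousLinearEquiv
  have he : HasStrictFDerivAt f (e : E →L[ℝ] E) a := by
    have h : (e : E →L[ℝ] E) = f' := by ext; rfl
    rwa [h]
  exact ⟨_, he.toOpenPartialHomeomorph f |>.open_source.mem_nhds
    he.mem_toOpenPartialHomeomorph_source, (he.toOpenPartialHomeomorph f).injOn⟩

/-- The Jacobian matrix. -/
noncomputable def jacobian (f : (ι → ℝ) → ι → ℝ) (x : ι → ℝ) : Matrix ι ι ℝ :=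
  LinearMap.toMatrix' (fderiv ℝ f x : (ι → ℝ) →ₗ[ℝ] ι → ℝ)

theorem jacobian_mulVec (f : (ι → ℝ) → ι → ℝ) (x w : ι → ℝ) :
    (jacobian f x).mulVec w = fderiv ℝ f x w := by
  rw [jacobian, LinearMap.toMatrix'_mulVec]; rfl

/-- The generalised cross product of the gradients of all components but one. -/
noncomputable def crossField (f : (ι → ℝ) → ι → ℝ) (i₀ : ι) (x : ι → ℝ) : ι → ℝ :=
  fun k => (jacobian f x).adjugate k i₀

/-- One column of J · adj J = det J · 1: the field is tangent to the levels of all components but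
`i₀`, which it changes at the rate det J. -/
theorem fderiv_crossField (f : (ι → ℝ) → ι → ℝ) (i₀ : ι) (x : ι → ℝ) :
    fderiv ℝ f x (crossField f i₀ x) = Pi.single i₀ (jacobian f x).det := by
  rw [← jacobian_mulVec]
  ext k
  have := congrFun (congrFun (jacobian f x).mul_adjugate k) i₀
  rw [Matrix.mul_apply] at this
  simp only [Matrix.mulVec, dotProduct, crossField, this, Matrix.smul_apply, Matrix.one_apply,
    Pi.single_apply, smul_eq_mul, mul_ite, mul_one, mul_zero]

theorem det_updateRow_jacobian (f : (ι → ℝ) → ι → ℝ) (i₀ : ι) (x w : ι → ℝ) :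
    ((jacobian f x).updateRow i₀ w).det = ∑ k, w k * crossField f i₀ x k := by
  rw [Matrix.det_eq_sum_mul_adjugate_row _ i₀]
  refine Finset.sum_congr rfl fun k _ => ?_
  rw [Matrix.updateRow_self, crossField, Matrix.adjugate_apply, Matrix.adjugate_apply,
    Matrix.updateRow_idem]

theorem contDiff_jacobian {f : (ι → ℝ) → ι → ℝ} (hf : ContDiff ℝ ∞ f) (k l : ι) :
    ContDiff ℝ ∞ (fun x => jacobian f x k l) := by
  have h : (fun x => jacobian f x k l) = fun x => fderiv ℝ f x (Pi.single l 1) k := by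
    ext x
    rw [← jacobian_mulVec]
    simp
  rw [h]
  exact contDiff_pi.1 ((hf.fderiv_right (m := ∞) (by simp)).clm_apply contDiff_const) k

theorem contDiff_crossField {f : (ι → ℝ) → ι → ℝ} (hf : ContDiff ℝ ∞ f) (i₀ : ι) :
    ContDiff ℝ ∞ (crossField f i₀) := by
  rw [contDiff_pi]
  intro k
  simp only [crossField, Matrix.adjugate_apply, Matrix.det_apply, Units.smul_def, zsmul_eq_mul]
  refine ContDiff.sum fun σ _ => contDiff_const.mul (contDiff_prod fun l _ => ?_)
  simp only [Matrix.updateRow_apply]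
  split_ifs
  · exact contDiff_const
  · exact contDiff_jacobian hf _ _

/-- The remaining rows have a one-dimensional kernel, spanned by some v. With v itself as the row
`i₀` the matrix is injective, since v · v ≠ 0, so its cofactors along that row are not all zero. -/
theorem crossField_ne_zero {f : (ι → ℝ) → ι → ℝ} {i₀ : ι} {x : ι → ℝ}
    (hsurj : ∀ c : ι → ℝ, ∃ w, ∀ k, k ≠ i₀ → fderiv ℝ f x w k = c k) : crossField f i₀ x ≠ 0 := by
  intro h0
  -- otherwise the matrix would stay singular whatever replaces the row
  have hsing : ∀ w : ι → ℝ, ((jacobian f x).updateRow i₀ w).det = 0 := fun w => by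
    simp [det_updateRow_jacobian, h0]
  let A : (ι → ℝ) →ₗ[ℝ] ({k // k ≠ i₀} → ℝ) :=
    (LinearMap.funLeft ℝ ℝ ((↑) : {k // k ≠ i₀} → ι)) ∘ₗ (fderiv ℝ f x : (ι → ℝ) →ₗ[ℝ] ι → ℝ)
  have hA : Function.Surjective A := fun c => by
    obtain ⟨w, hw⟩ := hsurj (fun k => if h : k ≠ i₀ then c ⟨k, h⟩ else 0)
    refine ⟨w, funext fun k => ?_⟩
    simpa [A, k.2] using hw k k.2
  have hcard : Fintype.card {k // k ≠ i₀} + 1 = Fintype.card ι := by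
    have := Fintype.card_subtype_compl (fun k : ι => k = i₀)
    have h1 : 0 < Fintype.card ι := Fintype.card_pos_iff.2 ⟨i₀⟩
    simp only [Fintype.card_subtype_eq] at this
    simp only [ne_eq]
    omega
  have hker : Module.finrank ℝ (LinearMap.ker A) = 1 := by
    have := A.finrank_range_add_finrank_ker
    rw [LinearMap.range_eq_top.2 hA, finrank_top, Module.finrank_fintype_fun_eq_card,
      Module.finrank_fintype_fun_eq_card] at this
    omega
  obtain ⟨v, hv0, hv⟩ := finrank_eq_one_iff'.1 hker
  have hmul : ∀ u, ((jacobian f x).updateRow i₀ (v : ι → ℝ)).mulVec u = 0 → u = 0 := by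
    intro u hu
    have hu' : u ∈ LinearMap.ker A := by
      rw [LinearMap.mem_ker]
      ext k
      have := congrFun hu k
      rw [Matrix.mulVec, Matrix.updateRow_ne k.2] at this
      have h2 := congrFun (jacobian_mulVec f x u) k
      rw [Matrix.mulVec, this] at h2
      simpa [A] using h2.symm
    obtain ⟨t, ht⟩ := hv ⟨u, hu'⟩
    have ht' : u = t • (v : ι → ℝ) := by simpa using (congrArg Subtype.val ht).symm
    have h1 := congrFun hu i₀
    rw [Matrix.mulVec, Matrix.updateRow_self, ht'] at h1
    simp only [dotProduct_smul, smul_eq_mul, Pi.zero_apply, mul_eq_zero] at h1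
    rcases h1 with h1 | h1
    · rw [ht', h1, zero_smul]
    · exact absurd (Subtype.ext (dotProduct_self_eq_zero.1 h1)) hv0
  obtain ⟨u, hu0, hu⟩ := Matrix.exists_mulVec_eq_zero_iff.2 (hsing v)
  exact hu0 (hmul u hu)

theorem HasDerivAt.exists_lt_lt {φ : ℝ → ℝ} {m t : ℝ} (h : HasDerivAt φ m t) (hm : 0 < m)
    {ε : ℝ} (hε : 0 < ε) :
    ∃ s₁ s₂, t - ε < s₁ ∧ s₁ < t ∧ t < s₂ ∧ s₂ < t + ε ∧ φ s₁ < φ t ∧ φ t < φ s₂ := by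
  obtain ⟨ε₁, h1, H1⟩ := h.eventually_lt_left hm
  obtain ⟨ε₂, h2, H2⟩ := h.eventually_lt_right hm
  have p1 : 0 < min ε₁ ε := lt_min h1 hε
  have p2 : 0 < min ε₂ ε := lt_min h2 hε
  have := min_le_left ε₁ ε
  have := min_le_right ε₁ ε
  have := min_le_left ε₂ ε
  have := min_le_right ε₂ ε
  exact ⟨t - min ε₁ ε / 2, t + min ε₂ ε / 2, by linarith, by linarith, by linarith, by linarith,
    H1 _ (by linarith) (by linarith), H2 _ (by linarith) (by linarith)⟩

/-- Near a point where the remaining components are independent, their common level set is the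
trajectory of any multiple of the cross product. -/
theorem levelSet_box {f : (ι → ℝ) → ι → ℝ} (hf : ContDiff ℝ ∞ f) {i₀ : ι} {Y : (ι → ℝ) → ι → ℝ}
    {γ : ℝ → ι → ℝ} (hγ : IsTrajectory Y γ) (hY : Y (γ 0) = crossField f i₀ (γ 0))
    (hX : crossField f i₀ (γ 0) ≠ 0)
    (hM : ∀ t, ∀ k, k ≠ i₀ → f (γ t) k = f (γ 0) k) {ε : ℝ} (hε : 0 < ε) :
    ∃ W ∈ 𝓝 (γ 0), ∀ z ∈ W, (∀ k, k ≠ i₀ → f z k = f (γ 0) k) → ∃ s, |s| < ε ∧ z = γ s := by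
  set y := γ 0 with hy
  set X := crossField f i₀ y with hXdef
  let ℓ : (ι → ℝ) →L[ℝ] ℝ := ∑ k, X k • ContinuousLinearMap.proj k
  have hℓ : ∀ z, ℓ z = ∑ k, X k * z k := fun z => by simp [ℓ]
  -- Local coordinates: the component `i₀` is replaced by the linear functional ⟨X, ·⟩. The Jacobian
  -- at y becomes J with row `i₀` replaced by X, of determinant |X|² > 0, so Φ is injective near y.
  let Φ : (ι → ℝ) → ι → ℝ := fun z k => if k = i₀ then ℓ z else f z k
  let Φ' : (ι → ℝ) →L[ℝ] ι → ℝ := ContinuousLinearMap.pi fun k =>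
    if k = i₀ then ℓ else (ContinuousLinearMap.proj k).comp (fderiv ℝ f y)
  have hstrict : HasStrictFDerivAt f (fderiv ℝ f y) y :=
    hf.contDiffAt.hasStrictFDerivAt (by simp)
  have hΦ : HasStrictFDerivAt Φ Φ' y := by
    rw [hasStrictFDerivAt_pi']
    intro k
    by_cases hk : k = i₀
    · subst hk
      have : (ContinuousLinearMap.proj k).comp Φ' = ℓ := by
        ext; simp [Φ']
      rw [this]
      simpa [Φ] using ℓ.hasStrictFDerivAt
    · have : (ContinuousLinearMap.proj k).comp Φ' =
          (ContinuousLinearMap.proj k).comp (fderiv ℝ f y) := by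
        ext; simp [Φ', hk]
      rw [this]
      simpa [Φ, hk] using hasStrictFDerivAt_pi'.1 hstrict k
  have hpos : 0 < ∑ k, X k * X k :=
    lt_of_le_of_ne (Finset.sum_nonneg fun k _ => mul_self_nonneg _)
      fun h => hX (dotProduct_self_eq_zero.1 (by rw [dotProduct]; exact h.symm))
  have hinj : Function.Injective Φ' := by
    rw [injective_iff_map_eq_zero]
    intro u hu
    have hdet : ((jacobian f y).updateRow i₀ X).det ≠ 0 := by
      rw [det_updateRow_jacobian]; exact hpos.ne'
    refine Matrix.eq_zero_of_mulVec_eq_zero hdet (funext fun k => ?_)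
    have h1 := congrFun hu k
    by_cases hk : k = i₀
    · subst hk
      rw [Matrix.mulVec, Matrix.updateRow_self]
      simpa [Φ', hℓ, dotProduct] using h1
    · rw [Matrix.mulVec, Matrix.updateRow_ne hk]
      have h2 := congrFun (jacobian_mulVec f y u) k
      rw [Matrix.mulVec] at h2
      rw [h2]
      simpa [Φ', hk] using h1
  obtain ⟨U, hU, hUinj⟩ := hΦ.exists_injOn_of_injective hinj
  have hev : ∀ᶠ s in 𝓝 (0 : ℝ), γ s ∈ U := hγ.continuous.continuousAt.eventually hU
  obtain ⟨δ, hδ, hδU⟩ := Metric.eventually_nhds_iff.1 hev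
  have hψ : HasDerivAt (fun s => ℓ (γ s)) (∑ k, X k * X k) 0 := by
    have := ℓ.hasFDerivAt.comp_hasDerivAt (0 : ℝ) (hγ 0)
    rw [← hy, hY, hℓ] at this
    exact this
  obtain ⟨s₁, s₂, h1, h2, h3, h4, h5, h6⟩ := hψ.exists_lt_lt hpos (lt_min hδ hε)
  have e1 := min_le_left δ ε
  have e2 := min_le_right δ ε
  refine ⟨U ∩ ℓ ⁻¹' Ioo (ℓ (γ s₁)) (ℓ (γ s₂)),
    inter_mem hU (ℓ.continuous.continuousAt.preimage_mem_nhds (Ioo_mem_nhds h5 h6)), ?_⟩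
  rintro z ⟨hzU, hz⟩ hzM
  -- Some γ s has the same ℓ as z. The other components agree on the level set, so Φ identifies the
  -- two points.
  obtain ⟨s, hs, hsz⟩ := intermediate_value_Icc (f := fun s => ℓ (γ s)) (h2.trans h3).le
    (ℓ.continuous.comp hγ.continuous).continuousOn ⟨hz.1.le, hz.2.le⟩
  have hsabs : |s| < min δ ε := abs_lt.2 ⟨by linarith [hs.1], by linarith [hs.2]⟩
  refine ⟨s, hsabs.trans_le e2, hUinj hzU (hδU ?_) (funext fun k => ?_)⟩
  · simpa using hsabs.trans_le e1
  · by_cases hk : k = i₀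
    · simpa [Φ, hk] using hsz.symm
    · simp [Φ, hk, hzM k hk, hM s k hk]

/-- The cross product field is cut off outside the compact set to make it bounded and Lipschitz, so
that trajectories exist for all times. It stays tangent to the level sets, and it is unchanged on
the compact set. -/
theorem isArcEnd_of_submersion {f : (ι → ℝ) → ι → ℝ} (hf : ContDiff ℝ ∞ f) {a : ι → ℝ} {i₀ : ι}
    (hK : IsCompact {x | (∀ k, k ≠ i₀ → f x k = a k) ∧ f x i₀ ≤ a i₀})
    (hsurj : ∀ x, (∀ k, k ≠ i₀ → f x k = a k) → f x i₀ ≤ a i₀ →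
      ∀ c : ι → ℝ, ∃ w, ∀ k, k ≠ i₀ → fderiv ℝ f x w k = c k)
    (hreg : ∀ x, f x = a → Function.Injective (fderiv ℝ f x)) {x : ι → ℝ} (hx : f x = a) :
    IsArcEnd {x | (∀ k, k ≠ i₀ → f x k = a k) ∧ f x i₀ ≤ a i₀} (fun x => f x i₀) (a i₀) x := by
  obtain ⟨R, hR0, hR⟩ := hK.isBounded.exists_pos_norm_le
  let χ : ContDiffBump (0 : ι → ℝ) := ⟨R, R + 1, hR0, by linarith⟩
  have hχ : ∀ z ∈ {x | (∀ k, k ≠ i₀ → f x k = a k) ∧ f x i₀ ≤ a i₀}, χ z = 1 := fun z hz =>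
    χ.one_of_mem_closedBall (by simpa using hR z hz)
  let Y : (ι → ℝ) → ι → ℝ := fun z => χ z • crossField f i₀ z
  have hYd : ContDiff ℝ ∞ Y := χ.contDiff.smul (contDiff_crossField hf i₀)
  have hYc : HasCompactSupport Y := χ.hasCompactSupport.smul_right
  obtain ⟨κ, hκ⟩ := ContDiff.lipschitzWith_of_hasCompactSupport hYc hYd (by simp)
  obtain ⟨L, hL⟩ := hYc.exists_bound_of_continuous hYd.continuous
  have hder : ∀ γ, IsTrajectory Y γ → ∀ t,
      HasDerivAt (fun s => f (γ s)) (Pi.single i₀ (χ (γ t) * (jacobian f (γ t)).det)) t := by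
    intro γ hγ t
    have := (hf.differentiable (by simp) (γ t)).hasFDerivAt.comp_hasDerivAt t (hγ t)
    simp only [Y, map_smul, fderiv_crossField, ← Pi.single_smul, smul_eq_mul] at this
    exact this
  have hconst : ∀ γ, IsTrajectory Y γ → ∀ k, k ≠ i₀ → ∀ s t, f (γ s) k = f (γ t) k := by
    intro γ hγ k hk s t
    have hk' : ∀ t, HasDerivAt (fun s => f (γ s) k) 0 t := fun t => by
      simpa [hk] using hasDerivAt_pi.1 (hder γ hγ t) k
    exact is_const_of_deriv_eq_zero (fun t => (hk' t).differentiableAt) (fun t => (hk' t).deriv) s t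
  have := isArcEnd_of_trajectories (M := {x | ∀ k, k ≠ i₀ → f x k = a k}) (h := fun x => f x i₀)
    (g := fun z => χ z * (jacobian f z).det) (c := a i₀) (L := ⟨max L 0, le_max_right _ _⟩)
    (x := x) hκ (fun x => (hL x).trans (le_max_left _ _))
    (fun γ hγ h0 t k hk => (hconst γ hγ k hk t 0).trans (h0 k hk))
    (fun γ hγ t => by simpa using hasDerivAt_pi.1 (hder γ hγ t) i₀) hK ?_ ?_
    (fun k _ => congrFun hx k) (congrFun hx i₀)
  · exact this
  · intro γ hγ h0 hle ε hε
    obtain ⟨W, hW, H⟩ := levelSet_box hf hγ (by simp [Y, hχ _ ⟨h0, hle⟩])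
      (crossField_ne_zero (hsurj _ h0 hle)) (fun t k hk => hconst γ hγ k hk t 0) hε
    exact ⟨W, hW, fun z hz hzM => H z hz fun k hk => (hzM k hk).trans (h0 k hk).symm⟩
  · intro z hzM hzc
    have hza : f z = a := funext fun k => by
      by_cases hk : k = i₀
      · rw [hk]; exact hzc
      · exact hzM k hk
    rw [hχ z ⟨hzM, le_of_eq hzc⟩, one_mul]
    intro hdet
    obtain ⟨u, hu0, hu⟩ := Matrix.exists_mulVec_eq_zero_iff.2 hdet
    rw [jacobian_mulVec] at hu
    exact hu0 (hreg z hza (hu.trans (map_zero _).symm))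

end LevelCurves

/-! ### Parity from a free involution permuting arcs. -/

section ArcInvolution

open Set Filter Topology

variable {E : Type*} [NormedAddCommGroup E] {K : Set E} {h : E → ℝ} {c : ℝ}

theorem IsArcEnd.existsUnique_other {x : E} (hx : IsArcEnd K h c x) :
    ∃! y, y ∈ connectedComponentIn K x ∧ h y = c ∧ y ≠ x := by
  obtain ⟨T, hT, γ, hγc, hγi, h0, hA, hend⟩ := hx
  have hT1 : T ∈ Icc 0 T := ⟨hT.le, le_rfl⟩
  have hT0 : (0 : ℝ) ∈ Icc 0 T := ⟨le_rfl, hT.le⟩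
  refine ⟨γ T, ⟨hA ▸ mem_image_of_mem γ hT1, (hend T hT1).2 (Or.inr rfl), ?_⟩, ?_⟩
  · intro he
    exact hT.ne' (hγi hT1 hT0 (he.trans h0.symm))
  · rintro y ⟨hy, hyc, hyx⟩
    rw [← hA] at hy
    obtain ⟨t, ht, rfl⟩ := hy
    rcases (hend t ht).1 hyc with rfl | rfl
    · exact absurd h0 hyx
    · rfl

theorem image_connectedComponentIn_subset {σ : E → E} (hσ : Continuous σ)
    (hσK : MapsTo σ K K) {x : E} (hx : x ∈ K) :
    σ '' connectedComponentIn K x ⊆ connectedComponentIn K (σ x) :=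
  (isPreconnected_connectedComponentIn.image σ hσ.continuousOn).subset_connectedComponentIn
    (mem_image_of_mem σ (mem_connectedComponentIn hx))
    ((image_mono (connectedComponentIn_subset K x)).trans hσK.image_subset)

/-- An involution interchanging the two ends of an arc has a fixed point on it. -/
theorem IsArcEnd.exists_fixed {x : E} (hx : IsArcEnd K h c x) {σ : E → E} (hσ : Continuous σ)
    (hσσ : ∀ x, σ (σ x) = x) (hσK : MapsTo σ K K) (hxK : x ∈ K) (hc : h (σ x) = c)
    (hmem : σ x ∈ connectedComponentIn K x) :
    ∃ z ∈ K, σ z = z := by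
  by_cases hσx : σ x = x
  · exact ⟨x, hxK, hσx⟩
  obtain ⟨T, hT, γ, hγc, hγi, h0, hA, hend⟩ := hx
  have hT1 : T ∈ Icc 0 T := ⟨hT.le, le_rfl⟩
  have hT0 : (0 : ℝ) ∈ Icc 0 T := ⟨le_rfl, hT.le⟩
  have hσxT : σ x = γ T := by
    obtain ⟨t, ht, hte⟩ := hA ▸ hmem
    rcases (hend t ht).1 (hte ▸ hc) with rfl | rfl
    · exact absurd (hte.symm.trans h0) hσx
    · exact hte.symm
  -- σ maps the arc to itself, hence is conjugate under γ to a continuous self-map u of [0, T]. As u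
  -- swaps the ends, it has a fixed point by the intermediate value theorem.
  have hmaps : ∀ t : Icc 0 T, ∃ s : Icc 0 T, γ s = σ (γ t) := by
    intro t
    have h1 := image_connectedComponentIn_subset hσ hσK hxK
      (mem_image_of_mem σ (hA ▸ mem_image_of_mem γ t.2))
    rw [← connectedComponentIn_eq hmem, ← hA] at h1
    obtain ⟨s, hs, hse⟩ := h1
    exact ⟨⟨s, hs⟩, hse⟩
  choose u hu using hmaps
  have hemb : IsClosedEmbedding ((Icc 0 T).domRestrict γ) :=
    (continuousOn_iff_continuous_domRestrict.1 hγc).isClosedEmbedding hγi.injective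
  have hucont : Continuous u := by
    rw [hemb.isInducing.continuous_iff]
    have : (Icc 0 T).domRestrict γ ∘ u = σ ∘ (Icc 0 T).domRestrict γ := funext hu
    rw [this]
    exact hσ.comp (continuousOn_iff_continuous_domRestrict.1 hγc)
  have : PreconnectedSpace (Icc 0 T) := Subtype.preconnectedSpace isPreconnected_Icc
  have hu0 : u ⟨0, hT0⟩ = ⟨T, hT1⟩ := Subtype.ext (hγi (u _).2 hT1 (by rw [hu, h0, hσxT]))
  have huT : u ⟨T, hT1⟩ = ⟨0, hT0⟩ :=
    Subtype.ext (hγi (u _).2 hT0 (by rw [hu, ← hσxT, hσσ, h0]))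
  obtain ⟨t, ht⟩ := intermediate_value_univ₂ (a := ⟨T, hT1⟩) (b := ⟨0, hT0⟩)
    (continuous_subtype_val.comp hucont) continuous_subtype_val
    (by simp [huT, hT.le]) (by simp [hu0, hT.le])
  refine ⟨γ t, connectedComponentIn_subset K x (hA ▸ mem_image_of_mem γ t.2), ?_⟩
  rw [← hu t]
  exact congrArg γ ht

/-- If the points of a level set are ends of arcs, then the number of their classes modulo a free
involution is even. -/
theorem even_ncard_of_isArcEnd (harc : ∀ x ∈ K, h x = c → IsArcEnd K h c x) {σ : E → E}
    (hσ : Continuous σ) (hσσ : ∀ x, σ (σ x) = x) (hσK : MapsTo σ K K) (hσh : ∀ x, h (σ x) = h x)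
    (hfree : ∀ x ∈ K, σ x ≠ x) {P : Set E} (hP : ∀ x ∈ K, x ∈ P → connectedComponentIn K x ⊆ P)
    {β : Type*} (π : E → β)
    (hσP : MapsTo σ P P)
    (hπ : ∀ x ∈ K, h x = c → x ∈ P → ∀ y ∈ K, h y = c → y ∈ P →
      (π x = π y ↔ y = x ∨ y = σ x))
    (hfin : (π '' {x ∈ K | h x = c ∧ x ∈ P}).Finite) :
    Even (π '' {x ∈ K | h x = c ∧ x ∈ P}).ncard := by
  classical
  set B := {x ∈ K | h x = c ∧ x ∈ P} with hB
  have hσB : ∀ x ∈ B, σ x ∈ B := fun x hx =>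
    ⟨hσK hx.1, (hσh x).trans hx.2.1, hσP hx.2.2⟩
  -- τ x will be the other end of the arc of x. By uniqueness of that end, τ is an involution
  -- commuting with σ.
  have hex : ∀ x ∈ B, ∃ y ∈ B, y ∈ connectedComponentIn K x ∧ y ≠ x ∧
      ∀ z ∈ B, z ∈ connectedComponentIn K x → z ≠ x → z = y := by
    intro x hx
    obtain ⟨y, ⟨hy, hyc, hyx⟩, huniq⟩ := (harc x hx.1 hx.2.1).existsUnique_other
    exact ⟨y, ⟨connectedComponentIn_subset K x hy, hyc, hP x hx.1 hx.2.2 hy⟩, hy, hyx,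
      fun z hz hzx hne => huniq z ⟨hzx, hz.2.1, hne⟩⟩
  choose! τ hτB hτc hτne hτu using hex
  have hsymm : ∀ x ∈ B, ∀ y ∈ connectedComponentIn K x, x ∈ connectedComponentIn K y :=
    fun x hx y hy => connectedComponentIn_eq hy ▸ mem_connectedComponentIn hx.1
  have hττ : ∀ x ∈ B, τ (τ x) = x := fun x hx =>
    (hτu _ (hτB x hx) x hx (hsymm x hx _ (hτc x hx)) (hτne x hx).symm).symm
  have hτσ : ∀ x ∈ B, τ (σ x) = σ (τ x) := fun x hx =>
    (hτu _ (hσB x hx) _ (hσB _ (hτB x hx))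
      (image_connectedComponentIn_subset hσ hσK hx.1 (mem_image_of_mem σ (hτc x hx)))
      (fun he => hτne x hx (by rw [← hσσ (τ x), he, hσσ]))).symm
  have hτσne : ∀ x ∈ B, τ x ≠ σ x := by
    intro x hx he
    obtain ⟨z, hz, hzf⟩ := (harc x hx.1 hx.2.1).exists_fixed hσ hσσ hσK hx.1
      ((hσh x).trans hx.2.1) (he ▸ hτc x hx)
    exact hfree z hz hzf
  have hπ' : ∀ x ∈ B, ∀ y ∈ B, (π x = π y ↔ y = x ∨ y = σ x) := fun x hx y hy =>
    hπ x hx.1 hx.2.1 hx.2.2 y hy.1 hy.2.1 hy.2.2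
  have hrep : ∀ b ∈ π '' B, ∃ x ∈ B, π x = b := fun b hb => hb
  choose! r hrB hr using hrep
  rw [ncard_eq_toFinset_card _ hfin, ← ZMod.natCast_eq_zero_iff_even]
  -- Count modulo 2 with the involution that τ induces on the classes. It has no fixed class since τ
  -- x is neither x nor σ x.
  have := Finset.sum_involution (s := hfin.toFinset) (f := fun _ => (1 : ZMod 2))
    (fun b _ => π (τ (r b))) (fun _ _ => by decide) ?_ ?_ ?_
  · simpa using this
  · intro b hb _ he
    have hb' := hfin.mem_toFinset.1 hb
    have hx := hrB b hb'
    rcases (hπ' _ hx _ (hτB _ hx)).1 ((hr b hb').trans he.symm) with h1 | h1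
    · exact hτne _ hx h1
    · exact hτσne _ hx h1
  · intro b hb
    exact hfin.mem_toFinset.2 (mem_image_of_mem π (hτB _ (hrB b (hfin.mem_toFinset.1 hb))))
  · intro b hb
    have hb' := hfin.mem_toFinset.1 hb
    have hx := hrB b hb'
    have hy := hτB _ hx
    have hmem : π (τ (r b)) ∈ π '' B := mem_image_of_mem π hy
    have hx' := hrB _ hmem
    rcases (hπ' _ hy _ hx').1 (hr _ hmem).symm with h1 | h1
    · rw [h1, hττ _ hx, hr b hb']
    · rw [h1, hτσ _ hy, hττ _ hx]
      exact ((hπ' _ hx _ (hσB _ hx)).2 (Or.inr rfl)).symm.trans (hr b hb')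

end ArcInvolution

namespace Framework

open Set Filter Topology
open scoped ContDiff

/-! ### Congruence in terms of distances. -/

section Congruence

variable {V : Type*} {d : ℕ}

/-- The bilinear form whose diagonal is the squared distance between two points. -/
noncomputable def distForm (p w : Configuration V d) (u v : V) : ℝ :=
  ∑ l, (p u l - p v l) * (w u l - w v l)

theorem distForm_eq_inner (p w : Configuration V d) (u v : V) :
    distForm p w u v = inner ℝ (p u - p v) (w u - w v) := by
  simp [distForm, PiLp.inner_apply, mul_comm]

theorem distForm_self (p : Configuration V d) (u v : V) :
    distForm p p u v = dist (p u) (p v) ^ 2 := by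
  rw [distForm_eq_inner, real_inner_self_eq_norm_sq, dist_eq_norm]

theorem distForm_symm (p w : Configuration V d) (u v : V) :
    distForm p w u v = distForm p w v u := by
  unfold distForm
  exact Finset.sum_congr rfl fun l _ => by ring

theorem dist_eq_iff_distForm {p q : Configuration V d} {u v : V} :
    dist (q u) (q v) = dist (p u) (p v) ↔ distForm q q u v = distForm p p u v := by
  rw [distForm_self, distForm_self, sq_eq_sq₀ dist_nonneg dist_nonneg]

theorem IsCongruent.dist_eq {p q : Configuration V d} (h : IsCongruent p q) (u v : V) :
    dist (q u) (q v) = dist (p u) (p v) := by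
  obtain ⟨g, hg⟩ := h
  rw [hg, hg, g.dist_map]

/-- The distances determine the Gram matrix of the vectors from a base vertex o, hence the norms of
their linear combinations. So p v - p o ↦ q v - q o defines a linear isometry on the span, which
extends to the whole space. -/
theorem isCongruent_of_dist_eq [Fintype V] {p q : Configuration V d}
    (h : ∀ u v, dist (q u) (q v) = dist (p u) (p v)) : IsCongruent p q := by
  classical
  rcases isEmpty_or_nonempty V with hV | ⟨⟨o⟩⟩
  · exact ⟨AffineIsometryEquiv.refl ℝ _, fun i => hV.elim i⟩
  let P : (V → ℝ) →ₗ[ℝ] EuclideanSpace ℝ (Fin d) := Fintype.linearCombination ℝ fun v => p v - p o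
  let Q : (V → ℝ) →ₗ[ℝ] EuclideanSpace ℝ (Fin d) := Fintype.linearCombination ℝ fun v => q v - q o
  have hP : ∀ v, P (Pi.single v 1) = p v - p o := fun v => by
    simp [P, Fintype.linearCombination_apply_single]
  have hQ : ∀ v, Q (Pi.single v 1) = q v - q o := fun v => by
    simp [Q, Fintype.linearCombination_apply_single]
  have hin : ∀ u v, inner ℝ (q u - q o) (q v - q o) = inner ℝ (p u - p o) (p v - p o) := by
    intro u v
    have e : ∀ r : Configuration V d, inner ℝ (r u - r o) (r v - r o) =
        (dist (r u) (r o) ^ 2 + dist (r v) (r o) ^ 2 - dist (r u) (r v) ^ 2) / 2 := by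
      intro r
      have := norm_sub_sq_real (r u - r o) (r v - r o)
      rw [sub_sub_sub_cancel_right] at this
      rw [dist_eq_norm, dist_eq_norm, dist_eq_norm, this]
      ring
    rw [e, e, h, h, h]
  have hnorm : ∀ c, ‖Q c‖ = ‖P c‖ := by
    intro c
    rw [← sq_eq_sq₀ (norm_nonneg _) (norm_nonneg _), ← real_inner_self_eq_norm_sq,
      ← real_inner_self_eq_norm_sq]
    simp only [P, Q, Fintype.linearCombination_apply, sum_inner, inner_sum, inner_smul_left,
      inner_smul_right, hin]
  obtain ⟨s, hs⟩ := P.rangeRestrict.exists_rightInverse_of_surjective P.range_rangeRestrict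
  have hs' : ∀ y, P (s y) = y := fun y => congrArg Subtype.val (LinearMap.congr_fun hs y)
  let L : LinearMap.range P →ₗᵢ[ℝ] EuclideanSpace ℝ (Fin d) :=
    ⟨Q ∘ₗ s, fun y => by rw [LinearMap.comp_apply, hnorm, hs']; rfl⟩
  have hL : ∀ c, L.extend (P c) = Q c := by
    intro c
    have h1 := L.extend_apply ⟨P c, LinearMap.mem_range_self P c⟩
    refine h1.trans ?_
    change Q (s _) = Q c
    rw [← sub_eq_zero, ← map_sub, ← norm_eq_zero, hnorm, map_sub, hs']
    simp
  let g : EuclideanSpace ℝ (Fin d) ≃ᵃⁱ[ℝ] EuclideanSpace ℝ (Fin d) :=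
    ((AffineIsometryEquiv.vaddConst ℝ (p o)).symm.trans
      (L.extend.toLinearIsometryEquiv rfl).toAffineIsometryEquiv).trans
      (AffineIsometryEquiv.vaddConst ℝ (q o))
  refine ⟨g, fun v => ?_⟩
  have : g (p v) = L.extend (p v - p o) + q o := rfl
  rw [this, ← hP, hL, hQ, sub_add_cancel]

theorem isCongruent_iff [Fintype V] {p q : Configuration V d} :
    IsCongruent p q ↔ ∀ u v, distForm q q u v = distForm p p u v :=
  ⟨fun h u v => dist_eq_iff_distForm.1 (h.dist_eq u v),
    fun h => isCongruent_of_dist_eq fun u v => dist_eq_iff_distForm.2 (h u v)⟩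

theorem IsCongruent.symm {p q : Configuration V d} (h : IsCongruent p q) : IsCongruent q p :=
  (congruence V d).iseqv.symm h

theorem IsCongruent.trans {p q r : Configuration V d} (h : IsCongruent p q)
    (h' : IsCongruent q r) : IsCongruent p r :=
  (congruence V d).iseqv.trans h h'

theorem IsCongruent.isEquivalent {p q : Configuration V d} (h : IsCongruent p q)
    (G : SimpleGraph V) : IsEquivalent G p q := fun u v _ => h.dist_eq u v

end Congruence

/-! ### Pinned configurations as representatives of congruence classes. -/

section Pinned

variable {V : Type*} {d n : ℕ}

/-- The coordinates left free when the `k`-th vertex is confined to the span of the first `k`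
basis vectors. -/
abbrev FreeCoord (e : V ≃ Fin n) (d : ℕ) := {i : V × Fin d // (i.2 : ℕ) < e i.1}

/-- The configuration with given free coordinates, all others being zero. -/
noncomputable def pin (e : V ≃ Fin n) : (FreeCoord e d → ℝ) →ₗ[ℝ] Configuration V d where
  toFun x v := WithLp.toLp 2 fun l => if h : (l : ℕ) < e v then x ⟨(v, l), h⟩ else 0
  map_add' x y := by
    ext v l
    by_cases h : (l : ℕ) < e v <;> simp [h]
  map_smul' c x := by
    ext v l
    by_cases h : (l : ℕ) < e v <;> simp [h]

variable (e : V ≃ Fin n)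

theorem pin_apply (x : FreeCoord e d → ℝ) (v : V) (l : Fin d) :
    pin e x v l = if h : (l : ℕ) < e v then x ⟨(v, l), h⟩ else 0 := rfl

theorem pin_apply_of_lt (x : FreeCoord e d → ℝ) {v : V} {l : Fin d} (h : (l : ℕ) < e v) :
    pin e x v l = x ⟨(v, l), h⟩ := by rw [pin_apply, dif_pos h]

theorem pin_apply_of_le (x : FreeCoord e d → ℝ) {v : V} {l : Fin d} (h : (e v : ℕ) ≤ l) :
    pin e x v l = 0 := by rw [pin_apply, dif_neg (not_lt.2 h)]

theorem pin_apply_coe (x : FreeCoord e d → ℝ) (i : FreeCoord e d) :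
    pin e x i.1.1 i.1.2 = x i := by rw [pin_apply_of_lt e x i.2]

theorem pin_injective : Function.Injective (pin (d := d) e) := fun x y h => by
  ext i
  rw [← pin_apply_coe e x i, h, pin_apply_coe]

theorem exists_pin_eq {q : Configuration V d} (h : ∀ v, ∀ l : Fin d, (e v : ℕ) ≤ l → q v l = 0) :
    ∃ x, pin e x = q := by
  refine ⟨fun i => q i.1.1 i.1.2, ?_⟩
  ext v l
  rcases lt_or_ge (l : ℕ) (e v) with hl | hl
  · rw [pin_apply_of_lt e _ hl]
  · rw [pin_apply_of_le e _ hl, h v l hl]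

variable (hn : d + 2 ≤ n)

/-- The last free coordinate of the vertex number `j + 1`. -/
def diagCoord (j : Fin d) : FreeCoord e d :=
  ⟨(e.symm ⟨j + 1, by omega⟩, j), by simp⟩

/-- The same coordinate of the following vertex. -/
def subdiagCoord (j : Fin d) : FreeCoord e d :=
  ⟨(e.symm ⟨j + 2, by omega⟩, j), by simp⟩

theorem diagCoord_ne_subdiagCoord (i j : Fin d) : diagCoord e hn i ≠ subdiagCoord e hn j := by
  intro h
  simp only [diagCoord, subdiagCoord, Subtype.mk.injEq, Prod.mk.injEq,
    EmbeddingLike.apply_eq_iff_eq,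
    Fin.mk.injEq] at h
  omega

/-- Reflection in the last coordinate. -/
def reflect (x : FreeCoord e d → ℝ) : FreeCoord e d → ℝ :=
  fun i => if (i.1.2 : ℕ) + 1 = d then -x i else x i

theorem reflect_reflect (x : FreeCoord e d → ℝ) : reflect e (reflect e x) = x := by
  ext i
  by_cases h : (i.1.2 : ℕ) + 1 = d <;> simp [reflect, h]

theorem continuous_reflect : Continuous (reflect (d := d) e) := by
  refine continuous_pi fun i => ?_
  unfold reflect
  split_ifs <;> fun_prop

theorem pin_reflect (x : FreeCoord e d → ℝ) (v : V) (l : Fin d) :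
    pin e (reflect e x) v l = if (l : ℕ) + 1 = d then -pin e x v l else pin e x v l := by
  rcases lt_or_ge (l : ℕ) (e v) with hl | hl
  · simp [pin_apply_of_lt e _ hl, reflect]
  · simp [pin_apply_of_le e _ hl]

theorem distForm_pin_reflect (x : FreeCoord e d → ℝ) (u v : V) :
    distForm (pin e (reflect e x)) (pin e (reflect e x)) u v =
      distForm (pin e x) (pin e x) u v := by
  unfold distForm
  refine Finset.sum_congr rfl fun l _ => ?_
  rw [pin_reflect, pin_reflect]
  split_ifs <;> ring

/-- Every configuration is congruent to a pinned one. -/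
theorem exists_isCongruent_pin [Fintype V] (q : Configuration V d) :
    ∃ x, IsCongruent q (pin e x) ∧ ∀ j, 0 ≤ x (diagCoord e hn j) := by
  set o := e.symm ⟨0, by omega⟩ with ho
  let f : Fin d → EuclideanSpace ℝ (Fin d) := fun j => q (e.symm ⟨j + 1, by omega⟩) - q o
  -- In the Gram–Schmidt basis of the vectors from vertex 0 to the vertices 1, …, d the coordinates
  -- are triangular, which is the pinning. The signs `s` make the diagonal nonnegative.
  let b := InnerProductSpace.gramSchmidtOrthonormalBasis (𝕜 := ℝ)
    (by simp : Module.finrank ℝ (EuclideanSpace ℝ (Fin d)) = Fintype.card (Fin d)) f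
  have htri : ∀ i j, i < j → inner ℝ (b j) (f i) = 0 := fun i j hij =>
    InnerProductSpace.gramSchmidtOrthonormalBasis_inv_triangular _ f hij
  let s : Fin d → ℝ := fun j => if inner ℝ (b j) (f j) < 0 then -1 else 1
  have hs : ∀ j, s j * s j = 1 := fun j => by simp only [s]; split_ifs <;> norm_num
  let r : Configuration V d := fun v => WithLp.toLp 2 fun l => s l * inner ℝ (b l) (q v - q o)
  have hr : ∀ v l, r v l = s l * inner ℝ (b l) (q v - q o) := fun _ _ => rfl
  obtain ⟨x, hx⟩ := exists_pin_eq e (q := r) (by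
    intro v l hl
    rw [hr]
    rcases Nat.eq_zero_or_pos (e v) with h0 | h0
    · have : v = o := by
        rw [ho, Equiv.eq_symm_apply]; exact Fin.ext h0
      simp [this]
    · have h1 := htri ⟨e v - 1, by omega⟩ l (by rw [Fin.lt_def]; simp only; omega)
      have h2 : f ⟨e v - 1, by omega⟩ = q v - q o := by
        simp only [f]
        congr 2
        rw [Equiv.symm_apply_eq]
        exact Fin.ext (by simp only; omega)
      rw [← h2, h1, mul_zero])
  refine ⟨x, ?_, fun j => ?_⟩
  · rw [hx]
    refine isCongruent_iff.2 fun u v => ?_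
    rw [distForm_eq_inner q q, ← b.sum_inner_mul_inner, distForm]
    refine Finset.sum_congr rfl fun l _ => ?_
    rw [hr, hr, ← mul_sub, ← inner_sub_right, sub_sub_sub_cancel_right, mul_mul_mul_comm, hs,
      one_mul, real_inner_comm (b l)]
  · rw [← pin_apply_coe e x, hx, hr]
    change 0 ≤ s j * inner ℝ (b j) (f j)
    simp only [s]
    split_ifs with h <;> linarith

/-- A pinned configuration is determined by its distances and the signs of its diagonal, up to the
last reflection. -/
theorem eq_or_eq_reflect (hd : 1 ≤ d) {x y : FreeCoord e d → ℝ}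
    (h : ∀ u v, distForm (pin e y) (pin e y) u v = distForm (pin e x) (pin e x) u v)
    (hsign : ∀ j : Fin d, (j : ℕ) + 1 < d →
      0 < x (diagCoord e hn j) * y (diagCoord e hn j)) : y = x ∨ y = reflect e x := by
  set o := e.symm ⟨0, by omega⟩ with ho
  have h0 : ∀ (z : FreeCoord e d → ℝ) l, pin e z o l = 0 := fun z l =>
    pin_apply_of_le e z (by simp [ho])
  have hin : ∀ u v, ∑ l, (pin e y u l * pin e y v l - pin e x u l * pin e x v l) = 0 := by
    intro u v
    have e1 : ∀ z : FreeCoord e d → ℝ, ∑ l, pin e z u l * pin e z v l =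
        (distForm (pin e z) (pin e z) u o + distForm (pin e z) (pin e z) v o -
          distForm (pin e z) (pin e z) u v) / 2 := by
      intro z
      simp only [distForm, h0, ← Finset.sum_add_distrib, ← Finset.sum_sub_distrib,
        Finset.sum_div]
      exact Finset.sum_congr rfl fun l _ => by ring
    rw [Finset.sum_sub_distrib, e1, e1, h, h, h, sub_self]
  -- Coordinate by coordinate: in the inner product with the vertex carrying the diagonal entry l,
  -- the earlier coordinates cancel by induction and the later ones vanish. The sign hypothesis
  -- identifies the diagonal entries, which are then cancelled.
  have hlow : ∀ m : ℕ, ∀ l : Fin d, (l : ℕ) = m → (l : ℕ) + 1 < d → ∀ v,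
      pin e y v l = pin e x v l := by
    intro m
    induction m using Nat.strong_induction_on with
    | _ m ih =>
      intro l hlm hl
      have hprod : ∀ v, pin e y (diagCoord e hn l).1.1 l * pin e y v l =
          pin e x (diagCoord e hn l).1.1 l * pin e x v l := by
        intro v
        have := hin (diagCoord e hn l).1.1 v
        rw [Finset.sum_eq_single l] at this
        · linarith
        · intro k _ hk
          rcases lt_or_gt_of_ne (Fin.val_ne_of_ne hk) with h1 | h1
          · rw [ih k (by omega) k rfl (by omega), ih k (by omega) k rfl (by omega), sub_self]
          · have hz : ∀ z : FreeCoord e d → ℝ, pin e z (diagCoord e hn l).1.1 k = 0 := fun z =>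
              pin_apply_of_le e z (by simp only [diagCoord, Equiv.apply_symm_apply]; omega)
            rw [hz, hz]; ring
        · simp
      have hdx := pin_apply_coe e x (diagCoord e hn l)
      have hdy := pin_apply_coe e y (diagCoord e hn l)
      have hs := hsign l hl
      rw [← hdx, ← hdy] at hs
      change 0 < pin e x _ l * pin e y _ l at hs
      have hsq := hprod (diagCoord e hn l).1.1
      have heq : pin e y (diagCoord e hn l).1.1 l = pin e x (diagCoord e hn l).1.1 l := by
        rcases mul_self_eq_mul_self_iff.1 hsq with h1 | h1
        · exact h1
        · rw [h1] at hs
          nlinarith [mul_self_nonneg (pin e x (diagCoord e hn l).1.1 l)]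
      intro v
      have := hprod v
      rw [heq] at this
      exact mul_left_cancel₀ (left_ne_zero_of_mul hs.ne') this
  let L : Fin d := ⟨d - 1, by omega⟩
  have hlow' : ∀ l : Fin d, l ≠ L → ∀ v, pin e y v l = pin e x v l := by
    intro l hl
    have : (l : ℕ) ≠ d - 1 := fun h => hl (Fin.ext h)
    exact hlow l l rfl (by omega)
  have hlast : ∀ u v, pin e y u L * pin e y v L = pin e x u L * pin e x v L := by
    intro u v
    have := hin u v
    rw [Finset.sum_eq_single L] at this
    · linarith
    · intro k _ hk
      rw [hlow' k hk, hlow' k hk, sub_self]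
    · simp
  -- The last coordinates are known only through their pairwise products, which determine them up to
  -- a common sign. Any nonzero entry, not necessarily the diagonal one, serves to compare the
  -- signs.
  have hcase : (∀ v, pin e y v L = pin e x v L) ∨ (∀ v, pin e y v L = -pin e x v L) := by
    by_cases hz : ∀ u, pin e x u L = 0
    · left
      intro v
      have := hlast v v
      rw [hz, mul_zero] at this
      rw [hz, mul_self_eq_zero.1 this]
    · push Not at hz
      obtain ⟨u, hu⟩ := hz
      rcases mul_self_eq_mul_self_iff.1 (hlast u u) with h1 | h1
      · left
        intro v
        have := hlast u v
        rw [h1] at this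
        exact mul_left_cancel₀ hu this
      · right
        intro v
        have := hlast u v
        rw [h1, neg_mul, ← mul_neg] at this
        linarith [mul_left_cancel₀ hu (by linarith : pin e x u L * (-pin e y v L) =
          pin e x u L * pin e x v L)]
  rcases hcase with hc | hc
  · left
    refine pin_injective e ?_
    ext v l
    by_cases hl : l = L
    · rw [hl, hc]
    · exact hlow' l hl v
  · right
    refine pin_injective e ?_
    ext v l
    rw [pin_reflect]
    by_cases hl : l = L
    · rw [hl, hc, if_pos]
      simp only [L]; omega
    · rw [if_neg, hlow' l hl v]
      intro h
      exact hl (Fin.ext (by simp only [L]; omega))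

end Pinned

end Framework

namespace Framework

open Set Filter Topology

/-! ### Edge lengths and the rigidity map. -/

section Lengths

variable {V : Type*} {d n : ℕ} (G : SimpleGraph V) (e : V ≃ Fin n)

/-- The edges of `G`, each oriented upwards for the ordering `e`. -/
abbrev OrientedEdge := {p : V × V // G.Adj p.1 p.2 ∧ e p.1 < e p.2}

noncomputable instance [Finite V] : Fintype (OrientedEdge G e) := Fintype.ofFinite _

/-- The squared edge lengths of a configuration. -/
noncomputable def edgeLengths (q : Configuration V d) : OrientedEdge G e → ℝ :=
  fun E => distForm q q E.1.1 E.1.2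

/-- Half the derivative of `edgeLengths`: the rigidity matrix as a linear map. -/
noncomputable def rigidityMap (q : Configuration V d) :
    Configuration V d →ₗ[ℝ] (OrientedEdge G e → ℝ) where
  toFun w E := distForm q w E.1.1 E.1.2
  map_add' w w' := by
    ext E
    simp only [distForm, Pi.add_apply, PiLp.add_apply, ← Finset.sum_add_distrib]
    exact Finset.sum_congr rfl fun l _ => by ring
  map_smul' c w := by
    ext E
    simp only [distForm, Pi.smul_apply, PiLp.smul_apply, smul_eq_mul, Finset.mul_sum,
      RingHom.id_apply]
    exact Finset.sum_congr rfl fun l _ => by ring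

theorem rigidityMap_apply (q w : Configuration V d) (E : OrientedEdge G e) :
    rigidityMap G e q w E = distForm q w E.1.1 E.1.2 := rfl

variable {G} in
theorem forall_adj_iff {φ : V → V → Prop} (hφ : ∀ u v, φ u v → φ v u) :
    (∀ u v, G.Adj u v → φ u v) ↔ ∀ E : OrientedEdge G e, φ E.1.1 E.1.2 := by
  refine ⟨fun h E => h _ _ E.2.1, fun h u v ha => ?_⟩
  rcases lt_or_gt_of_ne (e.injective.ne ha.ne) with hlt | hlt
  · exact h ⟨(u, v), ha, hlt⟩
  · exact hφ _ _ (h ⟨(v, u), ha.symm, hlt⟩)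

theorem isEquivalent_iff {p q : Configuration V d} :
    IsEquivalent G p q ↔ edgeLengths G e q = edgeLengths G e p := by
  simp only [IsEquivalent, dist_eq_iff_distForm]
  rw [forall_adj_iff e (fun u v h => by rw [distForm_symm q, distForm_symm p, h]), funext_iff]
  rfl

theorem isInfinitesimalFlex_iff {p v : Configuration V d} :
    IsInfinitesimalFlex G p v ↔ rigidityMap G e p v = 0 := by
  simp only [IsInfinitesimalFlex, ← distForm_eq_inner]
  rw [forall_adj_iff e (fun u v h => by rw [distForm_symm, h]), funext_iff]
  rfl

theorem IsCongruent.edgeLengths_eq {p q : Configuration V d} (h : IsCongruent p q) :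
    edgeLengths G e q = edgeLengths G e p :=
  (isEquivalent_iff G e).1 (h.isEquivalent G)

/-- Without self-stress the rigidity map is onto. -/
theorem IsIndependent.rigidityMap_surjective [Fintype V] {p : Configuration V d}
    (hp : IsIndependent G p) : Function.Surjective (rigidityMap G e p) := by
  classical
  rw [← LinearMap.range_eq_top]
  by_contra hne
  obtain ⟨φ, hφ0, hφ⟩ := Submodule.exists_le_ker_of_lt_top _ (lt_top_iff_ne_top.2 hne)
  let c : OrientedEdge G e → ℝ := fun E => φ (Pi.single E 1)
  have hφc : ∀ y, φ y = ∑ E, y E * c E := fun y => by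
    conv_lhs => rw [pi_eq_sum_univ' y]
    simp [c]
  let s : V → V → ℝ := fun i j =>
    if h : G.Adj i j ∧ e i < e j then c ⟨(i, j), h⟩
    else if h : G.Adj j i ∧ e j < e i then c ⟨(j, i), h⟩ else 0
  have hs : ∀ E : OrientedEdge G e, s E.1.1 E.1.2 = c E := fun E => dif_pos E.2
  have hsymm : ∀ i j, s i j = s j i := by
    intro i j
    simp only [s]
    split_ifs with h1 h2
    · exact absurd (h1.2.trans h2.2) (lt_irrefl _)
    all_goals rfl
  have hoff : ∀ i j, ¬ G.Adj i j → s i j = 0 := by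
    intro i j hij
    simp [s, hij, G.adj_comm j i]
  -- A functional vanishing on the range gives edge weights `s`, and `w` is their resultant force at
  -- each vertex. Tested on the velocity `w` itself, the functional gives ∑ |w i|² = 0, so `s` is a
  -- self-stress.
  let w : Configuration V d := fun i => ∑ j, s i j • (p i - p j)
  have hzero : ∑ i, ∑ j, s i j * inner ℝ (p i - p j) (w i) = 0 := by
    have h1 : φ (rigidityMap G e p w) = 0 := hφ (LinearMap.mem_range_self _ w)
    rw [hφc] at h1
    have h2 : ∑ E : OrientedEdge G e, rigidityMap G e p w E * c E =
        ∑ x : V × V, if e x.1 < e x.2 then s x.1 x.2 * inner ℝ (p x.1 - p x.2) (w x.1) +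
          s x.2 x.1 * inner ℝ (p x.2 - p x.1) (w x.2) else 0 := by
      rw [← Finset.sum_filter_add_sum_filter_not Finset.univ
        (fun x : V × V => G.Adj x.1 x.2 ∧ e x.1 < e x.2)
        (fun x : V × V => if e x.1 < e x.2 then _ else _),
        Finset.sum_subtype (p := fun x : V × V => G.Adj x.1 x.2 ∧ e x.1 < e x.2) _ (by simp),
        Finset.sum_eq_zero (s := Finset.univ.filter _), add_zero]
      · refine Finset.sum_congr rfl fun E _ => ?_
        rw [if_pos E.2.2, rigidityMap_apply, distForm_eq_inner, ← hs E, hsymm E.1.2 E.1.1,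
          ← neg_sub (p E.1.1) (p E.1.2), inner_neg_left, inner_sub_right]
        ring
      · intro x hx
        have hx' := (Finset.mem_filter.1 hx).2
        split_ifs with hlt
        · have : ¬ G.Adj x.1 x.2 := fun h => hx' ⟨h, hlt⟩
          rw [hoff _ _ this, hsymm, hoff _ _ this]
          simp
        · rfl
    rw [h2, Fintype.sum_prod_type] at h1
    have h3 : ∀ i j, (if e i < e j then s i j * inner ℝ (p i - p j) (w i) +
          s j i * inner ℝ (p j - p i) (w j) else 0) =
        (if e i < e j then s i j * inner ℝ (p i - p j) (w i) else 0) +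
        (if e i < e j then s j i * inner ℝ (p j - p i) (w j) else 0) := by
      intro i j
      split_ifs <;> simp
    simp only [h3, Finset.sum_add_distrib] at h1
    rw [Finset.sum_comm (f :=
        fun i j => if e i < e j then s j i * inner ℝ (p j - p i) (w j) else 0),
      ← Finset.sum_add_distrib] at h1
    rw [← h1]
    refine Finset.sum_congr rfl fun i _ => ?_
    rw [← Finset.sum_add_distrib]
    refine Finset.sum_congr rfl fun j _ => ?_
    rcases lt_trichotomy (e i) (e j) with h | h | h
    · simp [h, h.le]
    · rw [e.injective h]; simp
    · simp [h, h.le]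
  have hw : ∀ i, w i = 0 := by
    have h1 : ∑ i, inner ℝ (w i) (w i) = 0 := by
      rw [← hzero]
      refine Finset.sum_congr rfl fun i _ => ?_
      have h2 : inner ℝ (w i) (w i) = inner ℝ (∑ j, s i j • (p i - p j)) (w i) := rfl
      rw [h2, sum_inner]
      exact Finset.sum_congr rfl fun j _ => real_inner_smul_left _ _ _
    intro i
    exact inner_self_eq_zero.1 ((Finset.sum_eq_zero_iff_of_nonneg
      (fun i _ => real_inner_self_nonneg)).1 h1 i (Finset.mem_univ i))
  refine hφ0 (LinearMap.ext fun y => ?_)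
  rw [hφc]
  refine Finset.sum_eq_zero fun E _ => ?_
  rw [← hs, hp s ⟨hsymm, hoff, hw⟩, mul_zero]

end Lengths

/-! ### Derivations as velocities of configurations. -/

section Derivations

variable {V : Type*} {d n : ℕ} (D : Derivation ℚ ℝ ℝ)

/-- A derivation applied to all coordinates. -/
noncomputable def derive (q : Configuration V d) : Configuration V d :=
  fun v => WithLp.toLp 2 fun l => D (q v l)

theorem derive_apply (q : Configuration V d) (v : V) (l : Fin d) : derive D q v l = D (q v l) := rfl

/-- The bridge between algebra and rigidity: the coordinatewise derivative of q acts on squared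
lengths as an infinitesimal motion. -/
theorem derivation_distForm (q : Configuration V d) (u v : V) :
    D (distForm q q u v) = 2 * distForm q (derive D q) u v := by
  simp only [distForm, map_sum, Derivation.leibniz, map_sub, smul_eq_mul, derive_apply,
    Finset.mul_sum]
  exact Finset.sum_congr rfl fun l _ => by ring

theorem derive_pin (e : V ≃ Fin n) (x : FreeCoord e d → ℝ) :
    derive D (pin e x) = pin e fun i => D (x i) := by
  ext v l
  rw [derive_apply, pin_apply, pin_apply]
  split_ifs <;> simp

theorem exists_derivation_distForm_eq {κ : Type*} {π : κ → V × V} {q : Configuration V d}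
    (h : AlgebraicIndependent ℚ fun k => distForm q q (π k).1 (π k).2) (c : κ → ℝ) :
    ∃ D : Derivation ℚ ℝ ℝ, ∀ k, distForm q (derive D q) (π k).1 (π k).2 = c k := by
  obtain ⟨D, hD⟩ := h.exists_derivation fun k => 2 * c k
  refine ⟨D, fun k => ?_⟩
  have := hD k
  rw [derivation_distForm] at this
  linarith

theorem IsGeneric.exists_derive_eq {p : Configuration V d} (hp : IsGeneric p)
    (w : Configuration V d) : ∃ D, derive D p = w := by
  obtain ⟨D, hD⟩ := hp.exists_derivation fun x => w x.1 x.2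
  refine ⟨D, ?_⟩
  ext v l
  exact hD (v, l)

theorem isGeneric_of_derive [Fintype V] {p : Configuration V d} (h : ∀ w, ∃ D, derive D p = w) :
    IsGeneric p := by
  refine algebraicIndependent_of_derivations fun c => ?_
  obtain ⟨D, hD⟩ := h fun v => WithLp.toLp 2 fun l => c (v, l)
  refine ⟨D, fun x => ?_⟩
  rw [← derive_apply, hD]

/-- Every velocity of a generic p comes from a derivation, and the rigidity map is onto; so
derivations take arbitrary values on the lengths. -/
theorem IsGeneric.algebraicIndependent_edgeLengths [Fintype V] {G : SimpleGraph V}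
    {e : V ≃ Fin n} {p : Configuration V d} (hp : IsGeneric p) (hi : IsIndependent G p) :
    AlgebraicIndependent ℚ (edgeLengths G e p) := by
  refine algebraicIndependent_of_derivations fun c => ?_
  obtain ⟨w, hw⟩ := hi.rigidityMap_surjective G e fun E => c E / 2
  obtain ⟨D, hD⟩ := hp.exists_derive_eq w
  refine ⟨D, fun E => ?_⟩
  rw [edgeLengths, derivation_distForm, hD, ← rigidityMap_apply, hw]
  ring

/-- Whether the edge lengths of generic configurations are algebraically independent does not
depend on the configuration. -/
theorem IsGeneric.algebraicIndependent_edgeLengths_of {G : SimpleGraph V}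
    {e : V ≃ Fin n} {p q : Configuration V d} (hp : IsGeneric p) (hq : IsGeneric q)
    (h : AlgebraicIndependent ℚ (edgeLengths G e p)) :
    AlgebraicIndependent ℚ (edgeLengths G e q) := by
  let f : OrientedEdge G e → MvPolynomial (V × Fin d) ℚ := fun E =>
    ∑ l, (MvPolynomial.X (E.1.1, l) - MvPolynomial.X (E.1.2, l)) *
      (MvPolynomial.X (E.1.1, l) - MvPolynomial.X (E.1.2, l))
  have hf : ∀ r : Configuration V d,
      edgeLengths G e r = MvPolynomial.aeval (R := ℚ) (fun x : V × Fin d => r x.1 x.2) ∘ f := by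
    intro r
    ext E
    simp [f, edgeLengths, distForm]
  rw [hf] at h ⊢
  -- Evaluation of polynomials at a generic point is injective, so at either point independence
  -- means that of the length polynomials.
  exact ((AlgHom.algebraicIndependent_iff _ hq)).2 ((AlgHom.algebraicIndependent_iff _ hp).1 h)

end Derivations

/-! ### Nondegeneracy of realizations with one edge freed. -/

section Degenerate

variable {V : Type*} {d n : ℕ} {G : SimpleGraph V} {e : V ≃ Fin n}
  {a : OrientedEdge G e → ℝ} (ha : AlgebraicIndependent ℚ a)

/-- The restriction of the rigidity map to pinned configurations. -/
noncomputable def pinnedRigidityMap (G : SimpleGraph V) (e : V ≃ Fin n) (x : FreeCoord e d → ℝ) :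
    (FreeCoord e d → ℝ) →ₗ[ℝ] (OrientedEdge G e → ℝ) := rigidityMap G e (pin e x) ∘ₗ pin e

theorem pinnedRigidityMap_apply (x w : FreeCoord e d → ℝ) (E : OrientedEdge G e) :
    pinnedRigidityMap G e x w E = distForm (pin e x) (pin e w) E.1.1 E.1.2 := rfl

include ha in
theorem exists_derivation_pinnedRigidityMap {E₀ : OrientedEdge G e} {x : FreeCoord e d → ℝ}
    (hx : ∀ E, E ≠ E₀ → edgeLengths G e (pin e x) E = a E) (c : OrientedEdge G e → ℝ) :
    ∃ D : Derivation ℚ ℝ ℝ, ∀ E, E ≠ E₀ → pinnedRigidityMap G e x (fun i => D (x i)) E = c E := by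
  have h : AlgebraicIndependent ℚ fun E : {E // E ≠ E₀} => distForm (pin e x) (pin e x)
      (E : OrientedEdge G e).1.1 (E : OrientedEdge G e).1.2 := by
    convert ha.comp ((↑) : {E // E ≠ E₀} → OrientedEdge G e) Subtype.val_injective with E
    exact hx E E.2
  obtain ⟨D, hD⟩ := exists_derivation_distForm_eq (π := fun E : {E // E ≠ E₀} =>
    (E : OrientedEdge G e).1) h fun E => c E
  refine ⟨D, fun E hE => ?_⟩
  rw [pinnedRigidityMap_apply, ← derive_pin]
  exact hD ⟨E, hE⟩

include ha in
-- The derivations that take given values on the lengths supply the required velocities; x itself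
-- need not be generic.
theorem pinnedRigidityMap_surjective {x : FreeCoord e d → ℝ}
    (hx : edgeLengths G e (pin e x) = a) : Function.Surjective (pinnedRigidityMap G e x) := by
  intro c
  obtain ⟨D, hD⟩ := exists_derivation_distForm_eq (π := fun E : OrientedEdge G e => E.1)
    (q := pin e x) (hx ▸ ha : AlgebraicIndependent ℚ (edgeLengths G e (pin e x))) c
  refine ⟨fun i => D (x i), funext fun E => ?_⟩
  rw [pinnedRigidityMap_apply, ← derive_pin]
  exact hD E

variable [Fintype V] (hcard : Fintype.card (OrientedEdge G e) = Fintype.card (FreeCoord e d))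

include hcard ha in
theorem pinnedRigidityMap_injective {x : FreeCoord e d → ℝ}
    (hx : edgeLengths G e (pin e x) = a) : Function.Injective (pinnedRigidityMap G e x) :=
  (LinearMap.injective_iff_surjective_of_finrank_eq_finrank (by simp [hcard])).2
    (pinnedRigidityMap_surjective ha hx)

variable {E₀ : OrientedEdge G e} {x : FreeCoord e d → ℝ}
  (hx : ∀ E, E ≠ E₀ → edgeLengths G e (pin e x) E = a E)

include hcard ha hx in
/-- If a free coordinate vanishes, then the flexes within the coordinate hyperplane vanish. -/
theorem eq_zero_of_flex_of_coord {i : FreeCoord e d} (hi : x i = 0) {w : FreeCoord e d → ℝ}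
    (hwi : w i = 0) (hw : ∀ E, E ≠ E₀ → pinnedRigidityMap G e x w E = 0) : w = 0 := by
  classical
  -- The equation of `E₀` is replaced by the i-th coordinate. As D 0 = 0, velocities from
  -- derivations have i-th coordinate zero, so they adjust the other equations without disturbing
  -- this one. Thus T is onto, and injective by dimension.
  let T : (FreeCoord e d → ℝ) →ₗ[ℝ] (OrientedEdge G e → ℝ) :=
    LinearMap.pi fun E => if E = E₀ then LinearMap.proj i else
      LinearMap.proj E ∘ₗ pinnedRigidityMap G e x
  have hT0 : ∀ w, T w E₀ = w i := fun w => by simp [T]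
  have hT : ∀ w E, E ≠ E₀ → T w E = pinnedRigidityMap G e x w E := fun w E hE => by simp [T, hE]
  have hsurj : Function.Surjective T := by
    intro c
    obtain ⟨D, hD⟩ := exists_derivation_pinnedRigidityMap ha hx (c - T (Pi.single i (c E₀)))
    refine ⟨Pi.single i (c E₀) + fun i => D (x i), funext fun E => ?_⟩
    rw [map_add, Pi.add_apply]
    by_cases hE : E = E₀
    · rw [hE, hT0, hT0]
      simp [hi]
    · rw [hT (fun i => D (x i)) E hE, hD E hE]
      simp
  have hinj : Function.Injective T :=
    (LinearMap.injective_iff_surjective_of_finrank_eq_finrank (by simp [hcard])).2 hsurj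
  refine hinj ((funext fun E => ?_).trans (map_zero T).symm)
  by_cases hE : E = E₀
  · rw [hE, hT0, hwi]; rfl
  · rw [hT w E hE, hw E hE]; rfl

include hcard ha hx in
-- Some velocity D x has the effect of the j-th unit vector on the lengths other than that of `E₀`.
-- Both have i-th coordinate zero, so they are equal; but D 0 = 0 makes the j-th coordinate of D x
-- zero if x j = 0.
theorem not_two_coords_eq_zero {i j : FreeCoord e d} (hij : i ≠ j) (hi : x i = 0) : x j ≠ 0 := by
  classical
  intro hj
  obtain ⟨D, hD⟩ := exists_derivation_pinnedRigidityMap ha hx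
    (pinnedRigidityMap G e x (Pi.single j 1))
  have := eq_zero_of_flex_of_coord ha hcard hx hi
    (w := Pi.single j 1 - fun i => D (x i)) (by simp [hij, hi]) (fun E hE => by
      rw [map_sub, Pi.sub_apply, hD E hE, sub_self])
  have h1 := congrFun this j
  simp [hj] at h1

include hcard ha hx in
-- If this coordinate vanished, the infinitesimal rotation of the plane of the coordinates j and j +
-- 1 would be a pinned flex, hence zero by `eq_zero_of_flex_of_coord`. Then coordinate j of vertex j
-- + 2 vanishes as well, a second zero.
theorem diagCoord_ne_zero (hn : d + 2 ≤ n) {j : Fin d} (hj : (j : ℕ) + 1 < d) :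
    x (diagCoord e hn j) ≠ 0 := by
  classical
  intro h0
  let j' : Fin d := ⟨j + 1, hj⟩
  have hjj' : j ≠ j' := fun h => by simpa [j'] using congrArg Fin.val h
  -- the rotation of the plane of the two coordinates
  let r : Configuration V d := fun v => WithLp.toLp 2 fun l =>
    if l = j then -pin e x v j' else if l = j' then pin e x v j else 0
  have hr : ∀ v l, r v l = if l = j then -pin e x v j' else if l = j' then pin e x v j else 0 :=
    fun _ _ => rfl
  obtain ⟨w, hw⟩ := exists_pin_eq e (q := r) (by
    intro v l hl
    rw [hr]
    split_ifs with h1 h2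
    · rw [pin_apply_of_le e _ (by simp only [j']; omega), neg_zero]
    · rw [h2] at hl
      rcases (show (e v : ℕ) ≤ j + 1 from hl).lt_or_eq with h3 | h3
      · exact pin_apply_of_le e _ (by omega)
      · have : v = (diagCoord e hn j).1.1 := by
          simp only [diagCoord, Equiv.eq_symm_apply]
          exact Fin.ext h3
        rw [this]
        exact (pin_apply_coe e x (diagCoord e hn j)).trans h0
    · rfl)
  have hw0 : w = 0 := by
    refine eq_zero_of_flex_of_coord ha hcard hx h0 ?_ fun E _ => ?_
    · rw [← pin_apply_coe e w, hw, hr]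
      simp only [diagCoord, if_true]
      rw [pin_apply_of_le e _ (by simp [j']), neg_zero]
    · rw [pinnedRigidityMap_apply, hw, distForm,
        ← Finset.sum_subset (Finset.subset_univ {j, j'}), Finset.sum_pair hjj']
      · simp only [hr, if_true, hjj'.symm, if_false]
        ring
      · intro l _ hl
        simp only [Finset.mem_insert, Finset.mem_singleton, not_or] at hl
        simp [hr, hl.1, hl.2]
  refine not_two_coords_eq_zero ha hcard hx (diagCoord_ne_subdiagCoord e hn j j) h0 ?_
  rw [← pin_apply_coe e x]
  have h1 := hr (subdiagCoord e hn j).1.1 j'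
  rw [if_neg hjj'.symm, if_pos rfl, ← hw, hw0] at h1
  simpa [subdiagCoord] using h1.symm

include hcard ha hx in
-- At a fixed point the last coordinates of the vertices d and d + 1 are both zero.
theorem reflect_ne_self (hd : 1 ≤ d) (hn : d + 2 ≤ n) : reflect e x ≠ x := by
  intro h
  have key : ∀ i : FreeCoord e d, (i.1.2 : ℕ) + 1 = d → x i = 0 := by
    intro i hi
    have := congrFun h i
    rw [reflect, if_pos hi] at this
    linarith
  let L : Fin d := ⟨d - 1, by omega⟩
  have hL : (L : ℕ) + 1 = d := by simp only [L]; omega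
  exact not_two_coords_eq_zero ha hcard hx (diagCoord_ne_subdiagCoord e hn L L) (key _ hL)
    (key _ hL)

end Degenerate

end Framework

namespace Framework

open Set Filter Topology
open scoped ContDiff

/-! ### The length map as a smooth function of the free coordinates. -/

section Calculus

variable {V : Type*} [Fintype V] {d n : ℕ} (G : SimpleGraph V) (e : V ≃ Fin n)

/-- The difference of a coordinate of two vertices, as a functional on pinned configurations. -/
noncomputable def coordDiff (e : V ≃ Fin n) (u v : V) (l : Fin d) : (FreeCoord e d → ℝ) →L[ℝ] ℝ :=
  LinearMap.toContinuousLinearMap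
    { toFun := fun x => pin e x u l - pin e x v l
      map_add' := fun x y => by simp only [map_add, Pi.add_apply, PiLp.add_apply]; ring
      map_smul' := fun c x => by
        simp only [map_smul, Pi.smul_apply, PiLp.smul_apply, smul_eq_mul, RingHom.id_apply]; ring }

theorem coordDiff_apply (u v : V) (l : Fin d) (x : FreeCoord e d → ℝ) :
    coordDiff e u v l x = pin e x u l - pin e x v l := rfl

theorem edgeLengths_pin_eq (E : OrientedEdge G e) (x : FreeCoord e d → ℝ) :
    edgeLengths G e (pin e x) E =
      ∑ l, coordDiff e E.1.1 E.1.2 l x * coordDiff e E.1.1 E.1.2 l x := rfl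

theorem contDiff_edgeLengths_pin :
    ContDiff ℝ ∞ fun x : FreeCoord e d → ℝ => edgeLengths G e (pin e x) := by
  rw [contDiff_pi]
  intro E
  simp only [edgeLengths_pin_eq]
  fun_prop

theorem fderiv_edgeLengths_pin (x w : FreeCoord e d → ℝ) :
    fderiv ℝ (fun x : FreeCoord e d → ℝ => edgeLengths G e (pin e x)) x w =
      (2 : ℝ) • pinnedRigidityMap G e x w := by
  ext E
  have h : HasFDerivAt (fun x : FreeCoord e d → ℝ => edgeLengths G e (pin e x) E)
      (∑ l, (coordDiff e E.1.1 E.1.2 l x • coordDiff e E.1.1 E.1.2 l +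
        coordDiff e E.1.1 E.1.2 l x • coordDiff e E.1.1 E.1.2 l)) x := by
    simp only [edgeLengths_pin_eq]
    exact HasFDerivAt.fun_sum fun l _ =>
      (coordDiff e E.1.1 E.1.2 l).hasFDerivAt.mul (coordDiff e E.1.1 E.1.2 l).hasFDerivAt
  have h2 := hasFDerivAt_pi'.1 (((contDiff_edgeLengths_pin G e).differentiable
    (by simp) x).hasFDerivAt) E
  have h3 := congrArg (fun L => L w) (h2.unique h)
  simp only [ContinuousLinearMap.comp_apply, ContinuousLinearMap.proj_apply] at h3
  rw [h3, Pi.smul_apply, pinnedRigidityMap_apply, distForm]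
  simp only [sum_apply, add_apply, smul_apply, smul_eq_mul, coordDiff_apply, Finset.mul_sum]
  exact Finset.sum_congr rfl fun l _ => by ring

theorem continuous_edgeLengths_pin :
    Continuous fun x : FreeCoord e d → ℝ => edgeLengths G e (pin e x) :=
  (contDiff_edgeLengths_pin G e).continuous

theorem continuous_pin_apply (v : V) :
    Continuous fun x : FreeCoord e d → ℝ => pin e x v :=
  (LinearMap.continuous_of_finiteDimensional
    ((LinearMap.proj v : Configuration V d →ₗ[ℝ] _) ∘ₗ pin e))

end Calculus

/-! ### Nonzero diagonal for pinned copies of a generic configuration. -/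

section GenericDiagonal

variable {V : Type*} [Fintype V] {d n : ℕ} {e : V ≃ Fin n} (hn : d + 2 ≤ n)

theorem sum_mul_eq_of_isCongruent {p q : Configuration V d} (h : IsCongruent p q) (o u v : V) :
    ∑ l, (q u l - q o l) * (q v l - q o l) = ∑ l, (p u l - p o l) * (p v l - p o l) := by
  have key : ∀ r : Configuration V d, ∑ l, (r u l - r o l) * (r v l - r o l) =
      (distForm r r u o + distForm r r v o - distForm r r u v) / 2 := by
    intro r
    simp only [distForm, ← Finset.sum_add_distrib, ← Finset.sum_sub_distrib, Finset.sum_div]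
    exact Finset.sum_congr rfl fun l _ => by ring
  rw [key, key, isCongruent_iff.1 h, isCongruent_iff.1 h, isCongruent_iff.1 h]

theorem det_ne_zero_of_algebraicIndependent {m : ℕ} {P : Matrix (Fin m) (Fin m) ℝ}
    (h : AlgebraicIndependent ℚ fun x : Fin m × Fin m => P x.1 x.2) : P.det ≠ 0 := by
  have h1 : P = (MvPolynomial.aeval (R := ℚ) fun x : Fin m × Fin m => P x.1 x.2).mapMatrix
      (Matrix.mvPolynomialX (Fin m) (Fin m) ℚ) := by
    ext i j
    simp
  rw [h1, ← AlgHom.map_det]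
  exact fun h0 => Matrix.det_mvPolynomialX_ne_zero (Fin m) ℚ (h (h0.trans (map_zero _).symm))

/-- The vectors from vertex 0 to the vertices 1, …, d have the same Gram determinant in both
configurations. It is nonzero for p, and for the triangular pinned matrix it is the squared product
of the diagonal coordinates, the last one included. -/
theorem IsGeneric.diagCoord_ne_zero {p : Configuration V d} (hp : IsGeneric p)
    {x : FreeCoord e d → ℝ} (hx : IsCongruent p (pin e x)) (j : Fin d) :
    x (diagCoord e hn j) ≠ 0 := by
  set o := e.symm ⟨0, by omega⟩ with ho
  let b : Fin d → V := fun k => (diagCoord e hn k).1.1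
  have hb : ∀ k, (e (b k) : ℕ) = k + 1 := fun k => by simp [b, diagCoord]
  have ho0 : (e o : ℕ) = 0 := by simp [ho]
  let P : Matrix (Fin d) (Fin d) ℝ := Matrix.of fun k l => p (b k) l - p o l
  let X : Matrix (Fin d) (Fin d) ℝ := Matrix.of fun k l => pin e x (b k) l
  have hP : P.det ≠ 0 := by
    refine det_ne_zero_of_algebraicIndependent (algebraicIndependent_of_derivations fun c => ?_)
    obtain ⟨D, hD⟩ := hp.exists_derive_eq fun v => WithLp.toLp 2 fun l =>
      if h : (0 : ℕ) < e v ∧ (e v : ℕ) ≤ d then c (⟨e v - 1, by omega⟩, l) else 0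
    have hD' : ∀ v l, D (p v l) =
        if h : (0 : ℕ) < e v ∧ (e v : ℕ) ≤ d then c (⟨e v - 1, by omega⟩, l) else 0 := fun v l => by
      rw [← derive_apply, hD]
    refine ⟨D, fun kl => ?_⟩
    simp only [P, Matrix.of_apply, map_sub, hD']
    rw [dif_pos ⟨by rw [hb]; omega, by rw [hb]; omega⟩, dif_neg (by omega), sub_zero]
    congr 1
    exact Prod.ext (Fin.ext (by simp [hb])) rfl
  have hX : X.det ≠ 0 := by
    have hPX : P * P.transpose = X * X.transpose := by
      ext k k'
      have := sum_mul_eq_of_isCongruent hx o (b k) (b k')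
      have h0 : ∀ l, pin e x o l = 0 := fun l => pin_apply_of_le e x (by omega)
      simp only [h0, sub_zero] at this
      simpa [Matrix.mul_apply, P, X] using this.symm
    have := congrArg Matrix.det hPX
    rw [Matrix.det_mul, Matrix.det_mul, Matrix.det_transpose, Matrix.det_transpose] at this
    intro h0
    rw [h0, mul_zero] at this
    exact hP (mul_self_eq_zero.1 this)
  rw [Matrix.det_of_isLowerTriangular X (fun k l hkl => pin_apply_of_le e x (by
    rw [hb]; exact hkl))] at hX
  have := Finset.prod_ne_zero_iff.1 hX j (Finset.mem_univ j)
  simp only [X, Matrix.of_apply] at this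
  rw [← pin_apply_coe e x]
  exact this

end GenericDiagonal

/-! ### As many edges as free coordinates. -/

section Count

variable {V : Type*} [Fintype V] {d n : ℕ} {G : SimpleGraph V} {e : V ≃ Fin n}

/-- Generic local rigidity rules out flexes among pinned configurations. -/
theorem IsLocallyRigid.pinnedRigidityMap_injective (hd : 1 ≤ d) (hn : d + 2 ≤ n)
    {p : Configuration V d} (hp : IsGeneric p) (hr : IsLocallyRigid G p) {x : FreeCoord e d → ℝ}
    (hx : IsCongruent p (pin e x)) (hsurj : Function.Surjective (pinnedRigidityMap G e x)) :
    Function.Injective (pinnedRigidityMap G e x) := by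
  classical
  rw [injective_iff_map_eq_zero]
  intro u hu
  by_contra hu0
  obtain ⟨i, hi⟩ := Function.ne_iff.1 hu0
  let f : (FreeCoord e d → ℝ) → OrientedEdge G e → ℝ := fun z => edgeLengths G e (pin e z)
  have hf : HasStrictFDerivAt f (fderiv ℝ f x) x :=
    (contDiff_edgeLengths_pin G e).contDiffAt.hasStrictFDerivAt (by simp)
  let π : (FreeCoord e d → ℝ) →L[ℝ] ℝ := ContinuousLinearMap.proj i
  have hΨ : HasStrictFDerivAt (fun z => (f z, π z)) ((fderiv ℝ f x).prod π) x :=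
    hf.prodMk π.hasStrictFDerivAt
  -- The flex u moves coordinate i at first order without changing the lengths, so lengths and
  -- coordinate i together form a submersion.
  have hrange : ((fderiv ℝ f x).prod π).range = ⊤ := by
    rw [LinearMap.range_eq_top]
    rintro ⟨c, s⟩
    obtain ⟨w, hw⟩ := hsurj ((2 : ℝ)⁻¹ • c)
    refine ⟨w + ((s - w i) / u i) • u, Prod.ext ?_ ?_⟩
    · change fderiv ℝ f x _ = c
      rw [fderiv_edgeLengths_pin, map_add, map_smul, hu, hw]
      simp
    · change w i + (s - w i) / u i * u i = s
      rw [div_mul_cancel₀ _ hi]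
      ring
  obtain ⟨ε, hε, hrig⟩ := hr
  have hU : {z : FreeCoord e d → ℝ | (∀ v, dist (pin e z v) (pin e x v) < ε) ∧
      ∀ j, 0 < x (diagCoord e hn j) * z (diagCoord e hn j)} ∈ 𝓝 x := by
    refine inter_mem ?_ ?_
    · have : ∀ v, ∀ᶠ z in 𝓝 x, dist (pin e z v) (pin e x v) < ε := fun v =>
        (continuous_pin_apply e v).continuousAt (Metric.ball_mem_nhds _ hε)
      exact eventually_all.2 this
    · have : ∀ j, ∀ᶠ z : FreeCoord e d → ℝ in 𝓝 x,
          0 < x (diagCoord e hn j) * z (diagCoord e hn j) := fun j =>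
        (continuous_const.mul (continuous_apply _)).continuousAt.eventually
          (lt_mem_nhds (mul_self_pos.2 (hp.diagCoord_ne_zero hn hx j)))
      exact eventually_all.2 this
  -- A submersion is open: near x there is a z with the same lengths and another i-th coordinate.
  -- Local rigidity makes it congruent to x, and the diagonal signs, the last included, force z = x.
  have himg := image_mem_map (m := fun z => (f z, π z)) hU
  rw [hΨ.map_nhds_eq_of_surj hrange] at himg
  have hline : Tendsto (fun t : ℝ => (f x, π x + t)) (𝓝[≠] 0) (𝓝 (f x, π x)) := by
    have : Continuous fun t : ℝ => (f x, π x + t) := by fun_prop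
    have h := this.tendsto 0
    rw [add_zero] at h
    exact h.mono_left nhdsWithin_le_nhds
  obtain ⟨t, ht, ht0⟩ := ((hline.eventually himg).and eventually_mem_nhdsWithin).exists
  obtain ⟨z, ⟨hzε, hzs⟩, hz⟩ := ht
  obtain ⟨hzf, hzπ⟩ := Prod.ext_iff.1 hz
  obtain ⟨g, hg⟩ := hx.symm
  have hcong : IsCongruent (pin e z) fun v => g (pin e z v) := ⟨g, fun _ => rfl⟩
  have hpz : IsCongruent p fun v => g (pin e z v) := by
    refine hrig _ (fun v => ?_) ?_
    · rw [hg v, g.dist_map]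
      exact hzε v
    · rw [isEquivalent_iff G e, hcong.edgeLengths_eq, ← hx.edgeLengths_eq]
      exact hzf
  have hxz : IsCongruent (pin e x) (pin e z) := (hx.symm.trans hpz).trans hcong.symm
  rcases eq_or_eq_reflect e hn hd (isCongruent_iff.1 hxz) (fun j _ => hzs j) with h | h
  · rw [h] at hzπ
    simp only [left_eq_add] at hzπ
    exact ht0 hzπ
  · have := hzs ⟨d - 1, by omega⟩
    rw [h, reflect, if_pos (by simp only [diagCoord]; omega)] at this
    nlinarith [mul_self_nonneg (x (diagCoord e hn ⟨d - 1, by omega⟩))]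

theorem IsIsostatic.card_eq (hd : 1 ≤ d) (hn : d + 2 ≤ n) {p : Configuration V d}
    (hp : IsGeneric p) (hi : IsIsostatic G p) :
    Fintype.card (OrientedEdge G e) = Fintype.card (FreeCoord e d) := by
  obtain ⟨x, hx, -⟩ := exists_isCongruent_pin e hn p
  have hsurj := pinnedRigidityMap_surjective (hp.algebraicIndependent_edgeLengths hi.2)
    (hx.edgeLengths_eq G e)
  have hinj := hi.1.pinnedRigidityMap_injective hd hn hp hx hsurj
  have := LinearEquiv.finrank_eq (LinearEquiv.ofBijective _ ⟨hinj, hsurj⟩)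
  simpa using this.symm

end Count

/-! ### Compactness, finite fibres and local rigidity. -/

section Compactness

variable {V : Type*} {d n : ℕ} {G : SimpleGraph V} {e : V ≃ Fin n}

/-- Without flexes among pinned configurations the graph is connected. -/
theorem reachable_of_pinnedRigidityMap_injective (hd : 1 ≤ d) {x : FreeCoord e d → ℝ}
    (h : Function.Injective (pinnedRigidityMap G e x)) {o : V} (ho : (e o : ℕ) = 0) (v : V) :
    G.Reachable o v := by
  classical
  by_contra hv
  let k : Fin d := ⟨0, by omega⟩
  -- Translating the vertices not reachable from o along the first axis is a flex. It is pinned, as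
  -- vertex 0 alone is constrained in that coordinate.
  let r : Configuration V d := fun v => WithLp.toLp 2 fun l =>
    if l = k ∧ ¬ G.Reachable o v then 1 else 0
  have hr : ∀ v l, r v l = if l = k ∧ ¬ G.Reachable o v then 1 else 0 := fun _ _ => rfl
  obtain ⟨w, hw⟩ := exists_pin_eq e (q := r) (by
    intro v l hl
    rw [hr, if_neg]
    rintro ⟨rfl, hv⟩
    have : v = o := e.injective (Fin.ext (by simp only [k] at hl; omega))
    exact hv (by rw [this]))
  have hw0 : w = 0 := by
    refine h ((funext fun E => ?_).trans (map_zero _).symm)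
    rw [pinnedRigidityMap_apply, hw, distForm]
    refine Finset.sum_eq_zero fun l _ => ?_
    have : G.Reachable o E.1.1 ↔ G.Reachable o E.1.2 :=
      ⟨fun h => h.trans E.2.1.reachable, fun h => h.trans E.2.1.symm.reachable⟩
    rw [hr, hr, this, sub_self, mul_zero]
  have h1 := hr v k
  rw [← hw, hw0, if_pos ⟨rfl, hv⟩] at h1
  simp at h1

variable [Fintype V]

/-- Vertex o sits at the origin, and every other vertex is joined to it by a path of edges of
bounded length. -/
theorem isCompact_of_edgeLengths_le {o : V} (ho : (e o : ℕ) = 0)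
    (hconn : ∀ v, G.Reachable o v) {S : Set (FreeCoord e d → ℝ)} (hS : IsClosed S)
    {a : OrientedEdge G e → ℝ} (ha : ∀ x ∈ S, ∀ E, edgeLengths G e (pin e x) E ≤ a E) :
    IsCompact S := by
  have hadj : ∀ u v, G.Adj u v → ∃ C : ℝ, ∀ x ∈ S, dist (pin e x u) (pin e x v) ≤ C := by
    refine (forall_adj_iff e fun u v => ?_).2 fun E => ?_
    · simp only [dist_comm, imp_self]
    · refine ⟨√(a E), fun x hx => Real.le_sqrt_of_sq_le ?_⟩
      rw [← distForm_self]
      exact ha x hx E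
  have hbd : ∀ v, ∃ C : ℝ, ∀ x ∈ S, ‖pin e x v‖ ≤ C := by
    intro v
    obtain ⟨w⟩ := (hconn v).symm
    induction w with
    | @nil u =>
      refine ⟨0, fun x _ => ?_⟩
      have : pin e x u = 0 := by
        ext l
        exact pin_apply_of_le e x (by omega)
      rw [this, norm_zero]
    | cons h w ih =>
      obtain ⟨C, hC⟩ := ih ho hconn
      obtain ⟨C', hC'⟩ := hadj _ _ h
      refine ⟨C' + C, fun x hx => ?_⟩
      have := norm_sub_norm_le (pin e x _) (pin e x _) |>.trans
        ((dist_eq_norm _ _).symm.le.trans (hC' x hx))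
      linarith [hC x hx]
  choose C hC using hbd
  refine Metric.isCompact_of_isClosed_isBounded hS ?_
  refine (isBounded_iff_forall_norm_le).2 ⟨∑ v, |C v|, fun x hx => ?_⟩
  rw [pi_norm_le_iff_of_nonneg (Finset.sum_nonneg fun _ _ => abs_nonneg _)]
  intro i
  rw [← pin_apply_coe e x]
  calc ‖pin e x i.1.1 i.1.2‖ ≤ ‖pin e x i.1.1‖ := PiLp.norm_apply_le _ _
    _ ≤ |C i.1.1| := (hC _ x hx).trans (le_abs_self _)
    _ ≤ ∑ v, |C v| := Finset.single_le_sum (f := fun v => |C v|) (fun _ _ => abs_nonneg _)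
        (Finset.mem_univ _)

variable {a : OrientedEdge G e → ℝ} (ha : AlgebraicIndependent ℚ a)
  (hcard : Fintype.card (OrientedEdge G e) = Fintype.card (FreeCoord e d))
  {o : V} (ho : (e o : ℕ) = 0) (hconn : ∀ v, G.Reachable o v)

include ha hcard in
theorem exists_nhds_edgeLengths_injOn {x : FreeCoord e d → ℝ}
    (hx : edgeLengths G e (pin e x) = a) :
    ∃ U ∈ 𝓝 x, InjOn (fun z => edgeLengths G e (pin e z)) U := by
  classical
  let ε : FreeCoord e d ≃ OrientedEdge G e := (Fintype.equivOfCardEq hcard).symm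
  let R : (OrientedEdge G e → ℝ) →L[ℝ] (FreeCoord e d → ℝ) :=
    ContinuousLinearMap.pi fun i => ContinuousLinearMap.proj (ε i)
  have hR : ∀ y y', R y = R y' → y = y' := fun y y' h => funext fun E => by
    have := congrFun h (ε.symm E)
    simpa [R] using this
  have hf : HasStrictFDerivAt (fun z : FreeCoord e d → ℝ => edgeLengths G e (pin e z)) _ x :=
    (contDiff_edgeLengths_pin G e).contDiffAt.hasStrictFDerivAt (by simp)
  obtain ⟨U, hU, hinj⟩ := (R.hasStrictFDerivAt.comp x hf).exists_injOn_of_injective (by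
    intro w w' h
    have h1 : fderiv ℝ (fun x : FreeCoord e d → ℝ => edgeLengths G e (pin e x)) x w =
        fderiv ℝ (fun x : FreeCoord e d → ℝ => edgeLengths G e (pin e x)) x w' := hR _ _ h
    rw [fderiv_edgeLengths_pin, fderiv_edgeLengths_pin] at h1
    exact pinnedRigidityMap_injective ha hcard hx (smul_right_injective _ two_ne_zero h1))
  exact ⟨U, hU, fun z hz z' hz' h => hinj hz hz' (congrArg R h)⟩

include ha hcard ho hconn in
theorem finite_setOf_edgeLengths_eq :
    {x : FreeCoord e d → ℝ | edgeLengths G e (pin e x) = a}.Finite := by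
  have hK : IsCompact {x : FreeCoord e d → ℝ | edgeLengths G e (pin e x) = a} :=
    isCompact_of_edgeLengths_le ho hconn
      (isClosed_eq (continuous_edgeLengths_pin G e) continuous_const)
      fun x hx E => (congrFun hx E).le
  have := fun x : {x : FreeCoord e d → ℝ // edgeLengths G e (pin e x) = a} =>
    exists_nhds_edgeLengths_injOn ha hcard x.2
  choose U hU hinj using this
  obtain ⟨t, ht⟩ := hK.elim_nhds_subcover' (fun x hx => U ⟨x, hx⟩) (fun x hx => hU ⟨x, hx⟩)
  refine ((t.image Subtype.val).finite_toSet).subset fun x hx => ?_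
  obtain ⟨y, hy, hxy⟩ := mem_iUnion₂.1 (ht hx)
  have : x = y := hinj y hxy (mem_of_mem_nhds (hU y)) (hx.trans y.2.symm)
  rw [this]
  exact Finset.mem_image_of_mem _ hy

include ha hcard ho hconn in
-- The realizations form finitely many congruence classes, each closed, so q has a neighbourhood
-- that avoids all classes but its own.
theorem isLocallyRigid_of_edgeLengths_eq (hn : d + 2 ≤ n) {q : Configuration V d}
    (hq : edgeLengths G e q = a) : IsLocallyRigid G q := by
  have hcl : ∀ r : Configuration V d, IsClosed {z : Configuration V d | IsCongruent r z} := by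
    intro r
    simp only [isCongruent_iff, ofPred_forall]
    refine isClosed_iInter fun u => isClosed_iInter fun v => isClosed_eq ?_ continuous_const
    unfold distForm
    fun_prop
  have hfin : {x | edgeLengths G e (pin e x) = a ∧ ¬ IsCongruent (pin e x) q}.Finite :=
    (finite_setOf_edgeLengths_eq ha hcard ho hconn).subset fun x hx => hx.1
  have hopen := (hfin.isClosed_biUnion fun x _ => hcl (pin e x)).isOpen_compl.mem_nhds
    (show q ∈ _ from fun h => by
      obtain ⟨x, hx, hxq⟩ := mem_iUnion₂.1 h
      exact hx.2 hxq)
  obtain ⟨ε, hε, hball⟩ := Metric.mem_nhds_iff.1 hopen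
  refine ⟨ε, hε, fun z hz hez => ?_⟩
  by_contra hne
  obtain ⟨x, hx, -⟩ := exists_isCongruent_pin e hn z
  refine hball (show z ∈ Metric.ball q ε from (dist_pi_lt_iff hε).2 hz) ?_
  refine mem_iUnion₂.2 ⟨x, ⟨?_, fun h => hne ?_⟩, hx.symm⟩
  · rw [hx.edgeLengths_eq, ← hq]
    exact (isEquivalent_iff G e).1 hez
  · exact (hx.trans h).symm

end Compactness

end Framework

namespace Framework

open Set Filter Topology
open scoped ContDiff

/-! ### Splitting velocities into a rigid and a pinned part. -/

section TrivialFlexes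

variable {V : Type*} {d n : ℕ} {e : V ≃ Fin n} (hn : d + 2 ≤ n)

/-- The velocities `M p + b`. -/
noncomputable def affineVelocity (M : Matrix (Fin d) (Fin d) ℝ) (b : Fin d → ℝ)
    (p : Configuration V d) : Configuration V d :=
  fun v => WithLp.toLp 2 (M.mulVec (p v).ofLp + b)

theorem affineVelocity_apply (M : Matrix (Fin d) (Fin d) ℝ) (b : Fin d → ℝ)
    (p : Configuration V d) (v : V) (l : Fin d) :
    affineVelocity M b p v l = ∑ k, M l k * p v k + b l := rfl

theorem distForm_affineVelocity {M : Matrix (Fin d) (Fin d) ℝ} (hM : ∀ k l, M l k = -M k l)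
    (b : Fin d → ℝ) (p : Configuration V d) (u v : V) :
    distForm p (affineVelocity M b p) u v = 0 := by
  have h : distForm p (affineVelocity M b p) u v =
      ∑ l, ∑ k, M l k * ((p u l - p v l) * (p u k - p v k)) := by
    unfold distForm
    refine Finset.sum_congr rfl fun l _ => ?_
    rw [affineVelocity_apply, affineVelocity_apply, add_sub_add_right_eq_sub,
      ← Finset.sum_sub_distrib, Finset.mul_sum]
    exact Finset.sum_congr rfl fun k _ => by ring
  have h2 : distForm p (affineVelocity M b p) u v = -distForm p (affineVelocity M b p) u v := by
    conv_lhs => rw [h, Finset.sum_comm]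
    rw [h, ← Finset.sum_neg_distrib]
    refine Finset.sum_congr rfl fun l _ => ?_
    rw [← Finset.sum_neg_distrib]
    refine Finset.sum_congr rfl fun k _ => ?_
    rw [hM l k]
    ring
  linarith

variable {x : FreeCoord e d → ℝ}

/-- A rigid velocity that keeps a nondegenerate pinned configuration pinned vanishes. -/
theorem eq_zero_of_affineVelocity_pinned
    (hx : ∀ j : Fin d, (j : ℕ) + 1 < d → x (diagCoord e hn j) ≠ 0)
    {M : Matrix (Fin d) (Fin d) ℝ} (hM : ∀ k l, M l k = -M k l) {b : Fin d → ℝ}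
    (h : ∀ v, ∀ l : Fin d, (e v : ℕ) ≤ l → affineVelocity M b (pin e x) v l = 0) :
    M = 0 ∧ b = 0 := by
  have hb : b = 0 := by
    ext l
    have := h (e.symm ⟨0, by omega⟩) l (by simp)
    rw [affineVelocity_apply, Finset.sum_eq_zero, zero_add] at this
    · exact this
    · intro k _
      rw [pin_apply_of_le e x (by simp), mul_zero]
  -- The pinned coordinate l > k of vertex k + 1 involves only the columns up to k of M; the earlier
  -- ones are settled by induction.
  have key : ∀ m : ℕ, ∀ k : Fin d, (k : ℕ) = m → ∀ l, k < l → M l k = 0 := by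
    intro m
    induction m using Nat.strong_induction_on with
    | _ m ih =>
      intro k hkm l hkl
      rw [Fin.lt_def] at hkl
      have := h (diagCoord e hn k).1.1 l (by simp only [diagCoord, Equiv.apply_symm_apply]; omega)
      rw [affineVelocity_apply, hb, Pi.zero_apply, add_zero, Finset.sum_eq_single k] at this
      · have h1 := pin_apply_coe e x (diagCoord e hn k)
        change pin e x _ k = _ at h1
        rw [h1] at this
        exact (mul_eq_zero.1 this).resolve_right (hx k (by omega))
      · intro k' _ hk'
        rcases lt_or_gt_of_ne (Fin.val_ne_of_ne hk') with h1 | h1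
        · rw [ih k' (by omega) k' rfl l (by rw [Fin.lt_def]; omega), zero_mul]
        · rw [pin_apply_of_le e x (by simp only [diagCoord, Equiv.apply_symm_apply]; omega),
            mul_zero]
      · simp
  refine ⟨?_, hb⟩
  ext l k
  rcases lt_trichotomy k l with h1 | h1 | h1
  · exact key k k rfl l h1
  · have := hM k l
    rw [h1] at this ⊢
    rw [Matrix.zero_apply]
    linarith
  · rw [hM, key l l rfl k h1, neg_zero]
    rfl

/-- Every velocity splits into a rigid one and a pinned one. -/
theorem exists_eq_affineVelocity_add_pin [Fintype V]
    (hx : ∀ j : Fin d, (j : ℕ) + 1 < d → x (diagCoord e hn j) ≠ 0) (q : Configuration V d) :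
    ∃ M : Matrix (Fin d) (Fin d) ℝ, (∀ k l, M l k = -M k l) ∧ ∃ b w,
      q = affineVelocity M b (pin e x) + pin e w := by
  classical
  -- The pinned coordinates also index the rigid velocities: those of vertex 0 are the translation,
  -- and coordinate l of vertex k + 1 is the entry (l, k) of the skew matrix. So T is an
  -- endomorphism, and injectivity suffices.
  let Z := {i : V × Fin d // (e i.1 : ℕ) ≤ i.2}
  let B : (Z → ℝ) → Fin d → ℝ := fun a l => a ⟨(e.symm ⟨0, by omega⟩, l), by simp⟩
  let N : (Z → ℝ) → Matrix (Fin d) (Fin d) ℝ := fun a => Matrix.of fun l k =>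
    if h : k < l then a ⟨((diagCoord e hn k).1.1, l), by
      simp only [diagCoord, Equiv.apply_symm_apply]; exact h⟩
    else if h : l < k then -a ⟨((diagCoord e hn l).1.1, k), by
      simp only [diagCoord, Equiv.apply_symm_apply]; exact h⟩ else 0
  have hN : ∀ a k l, N a l k = -N a k l := by
    intro a k l
    simp only [N, Matrix.of_apply]
    split_ifs with h1 h2
    · exact absurd (h1.trans h2) (lt_irrefl _)
    all_goals simp
  have hNadd : ∀ a a' l k, N (a + a') l k = N a l k + N a' l k := by
    intro a a' l k
    simp only [N, Matrix.of_apply, Pi.add_apply]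
    split_ifs <;> ring
  have hNsmul : ∀ (c : ℝ) a l k, N (c • a) l k = c * N a l k := by
    intro c a l k
    simp only [N, Matrix.of_apply, Pi.smul_apply, smul_eq_mul]
    split_ifs <;> ring
  let T : (Z → ℝ) →ₗ[ℝ] (Z → ℝ) :=
    { toFun := fun a i => affineVelocity (N a) (B a) (pin e x) i.1.1 i.1.2
      map_add' := fun a a' => by
        ext i
        simp only [affineVelocity_apply, hNadd, add_mul, Finset.sum_add_distrib, B, Pi.add_apply]
        ring
      map_smul' := fun c a => by
        ext i
        simp only [affineVelocity_apply, hNsmul, mul_assoc, ← Finset.mul_sum, B, Pi.smul_apply,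
          smul_eq_mul, RingHom.id_apply]
        ring }
  have hinj : Function.Injective T := by
    rw [injective_iff_map_eq_zero]
    intro a ha
    obtain ⟨h1, h2⟩ := eq_zero_of_affineVelocity_pinned hn hx (hN a) (b := B a)
      fun v l hl => congrFun ha ⟨(v, l), hl⟩
    ext ⟨⟨v, l⟩, hvl⟩
    rcases Nat.eq_zero_or_pos (e v) with h0 | h0
    · have hv : v = e.symm ⟨0, by omega⟩ := by
        rw [Equiv.eq_symm_apply]; exact Fin.ext h0
      have h3 : a ⟨(e.symm ⟨0, by omega⟩, l), by simp⟩ = 0 := congrFun h2 l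
      refine Eq.trans (congrArg a ?_) h3
      exact Subtype.ext (Prod.ext hv rfl)
    · simp only at hvl
      have hv : v = (diagCoord e hn ⟨e v - 1, by omega⟩).1.1 := by
        simp only [diagCoord]
        rw [Equiv.eq_symm_apply]; exact Fin.ext (by simp only; omega)
      have h3 := congrFun (congrFun h1 l) ⟨e v - 1, by omega⟩
      simp only [N, Matrix.of_apply] at h3
      rw [dif_pos (by rw [Fin.lt_def]; simp only; omega)] at h3
      refine Eq.trans (congrArg a ?_) h3
      exact Subtype.ext (Prod.ext hv rfl)
  obtain ⟨a, ha⟩ := LinearMap.injective_iff_surjective.1 hinj fun i => q i.1.1 i.1.2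
  obtain ⟨w, hw⟩ := exists_pin_eq e (q := q - affineVelocity (N a) (B a) (pin e x))
    fun v l hl => sub_eq_zero.2 (congrFun ha ⟨(v, l), hl⟩).symm
  exact ⟨N a, hN a, B a, w, by rw [hw]; abel⟩

theorem eq_of_affineVelocity_add_pin_eq
    (hx : ∀ j : Fin d, (j : ℕ) + 1 < d → x (diagCoord e hn j) ≠ 0)
    {M M' : Matrix (Fin d) (Fin d) ℝ} (hM : ∀ k l, M l k = -M k l) (hM' : ∀ k l, M' l k = -M' k l)
    {b b' : Fin d → ℝ} {w w' : FreeCoord e d → ℝ}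
    (h : affineVelocity M b (pin e x) + pin e w = affineVelocity M' b' (pin e x) + pin e w') :
    M = M' ∧ b = b' ∧ w = w' := by
  have hsub : ∀ v l, affineVelocity (M - M') (b - b') (pin e x) v l =
      pin e w' v l - pin e w v l := by
    intro v l
    have h1 := congrArg (fun q : Configuration V d => q v l) h
    simp only [Pi.add_apply, PiLp.add_apply, affineVelocity_apply] at h1
    simp only [affineVelocity_apply, Matrix.sub_apply, sub_mul, Finset.sum_sub_distrib,
      Pi.sub_apply]
    linarith
  obtain ⟨h1, h2⟩ := eq_zero_of_affineVelocity_pinned hn hx (M := M - M') (b := b - b')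
    (fun k l => by rw [Matrix.sub_apply, Matrix.sub_apply, hM, hM']; ring)
    (fun v l hl => by rw [hsub, pin_apply_of_le e _ hl, pin_apply_of_le e _ hl, sub_zero])
  obtain rfl := sub_eq_zero.1 h1
  obtain rfl := sub_eq_zero.1 h2
  exact ⟨rfl, rfl, pin_injective e (add_left_cancel h)⟩

theorem isTrivialFlex_affineVelocity {M : Matrix (Fin d) (Fin d) ℝ} (hM : ∀ k l, M l k = -M k l)
    (b : Fin d → ℝ) (p : Configuration V d) : IsTrivialFlex p (affineVelocity M b p) := by
  refine ⟨Matrix.toEuclideanLin M, WithLp.toLp 2 b, fun y z => ?_, fun i => rfl⟩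
  simp only [PiLp.inner_apply, Matrix.toLpLin_apply, Matrix.mulVec, dotProduct, RCLike.inner_apply,
    conj_trivial, Finset.mul_sum, Finset.sum_mul]
  rw [Finset.sum_comm, ← Finset.sum_neg_distrib]
  refine Finset.sum_congr rfl fun l _ => ?_
  rw [← Finset.sum_neg_distrib]
  refine Finset.sum_congr rfl fun k _ => ?_
  rw [hM]
  ring

theorem isInfinitesimallyRigid_pin [Fintype V] {G : SimpleGraph V}
    (hx : ∀ j : Fin d, (j : ℕ) + 1 < d → x (diagCoord e hn j) ≠ 0)
    (hinj : Function.Injective (pinnedRigidityMap G e x)) :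
    IsInfinitesimallyRigid G (pin e x) := by
  intro v hv
  rw [isInfinitesimalFlex_iff G e] at hv
  obtain ⟨M, hM, b, w, rfl⟩ := exists_eq_affineVelocity_add_pin hn hx v
  have hw : w = 0 := by
    refine hinj ((funext fun E => ?_).trans (map_zero _).symm)
    have := congrFun hv E
    rw [map_add, Pi.add_apply, rigidityMap_apply, distForm_affineVelocity hM, zero_add] at this
    exact this
  rw [hw, map_zero, add_zero]
  exact isTrivialFlex_affineVelocity hM b _

theorem IsCongruent.isInfinitesimallyRigid {G : SimpleGraph V} {p q : Configuration V d}
    (h : IsCongruent p q) (hp : IsInfinitesimallyRigid G p) : IsInfinitesimallyRigid G q := by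
  obtain ⟨g, hg⟩ := h
  intro v hv
  let L := g.linearIsometryEquiv
  have hL : ∀ i j, q i - q j = L (p i - p j) := fun i j => by
    rw [hg, hg, ← vsub_eq_sub, ← vsub_eq_sub, ← g.map_vsub]
  obtain ⟨A, b, hA, hAb⟩ := hp (fun i => L.symm (v i)) (fun i j hij => by
    rw [← map_sub, ← L.inner_map_map, L.apply_symm_apply, ← hL]
    exact hv i j hij)
  refine ⟨L.toLinearEquiv.toLinearMap ∘ₗ A ∘ₗ L.symm.toLinearEquiv.toLinearMap,
    L b - L (A (L.symm (g 0))), fun y z => ?_, fun i => ?_⟩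
  · have h1 := hA (L.symm y) (L.symm z)
    have h2 := L.inner_map_map (A (L.symm y)) (L.symm z)
    have h3 := L.inner_map_map (L.symm y) (A (L.symm z))
    rw [L.apply_symm_apply] at h2 h3
    change inner ℝ (L (A (L.symm y))) z = -inner ℝ y (L (A (L.symm z)))
    rw [h2, h3, h1]
  · have h1 : q i = L (p i) + g 0 := by
      have := g.map_vadd 0 (p i)
      rw [vadd_eq_add, add_zero, vadd_eq_add] at this
      rw [hg, this]
    have h2 := congrArg L (hAb i)
    rw [L.apply_symm_apply] at h2
    change v i = L (A (L.symm (q i))) + _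
    rw [h2, h1, map_add L.symm, L.symm_apply_apply, map_add A, map_add, map_add]
    abel

end TrivialFlexes

/-! ### Equivalent frameworks are congruent to generic ones. -/

section GenericPosition

variable {V : Type*} [Fintype V] {d n : ℕ} {e : V ≃ Fin n} (hn : d + 2 ≤ n)

/-- An isometry in coordinates. -/
theorem exists_matrix_isometry
    (g : EuclideanSpace ℝ (Fin d) ≃ᵃⁱ[ℝ] EuclideanSpace ℝ (Fin d)) :
    ∃ (C : Matrix (Fin d) (Fin d) ℝ) (b : Fin d → ℝ), C.transpose * C = 1 ∧
      ∀ z, g z = WithLp.toLp 2 (C.mulVec z.ofLp + b) := by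
  classical
  let L := g.linearIsometryEquiv
  let C : Matrix (Fin d) (Fin d) ℝ := Matrix.toEuclideanLin.symm L.toLinearEquiv.toLinearMap
  have hC : ∀ z, L z = WithLp.toLp 2 (C.mulVec z.ofLp) := fun z => by
    have : Matrix.toEuclideanLin C = L.toLinearEquiv.toLinearMap :=
      LinearEquiv.apply_symm_apply _ _
    have h := LinearMap.congr_fun this z
    rw [Matrix.toLpLin_apply] at h
    exact h.symm
  refine ⟨C, (g 0).ofLp, ?_, fun z => ?_⟩
  · ext k k'
    have h1 := L.inner_map_map (EuclideanSpace.single k 1) (EuclideanSpace.single k' 1)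
    rw [hC, hC] at h1
    simp only [PiLp.inner_apply, RCLike.inner_apply, conj_trivial, PiLp.ofLp_single,
      Matrix.mulVec_single_one, Matrix.col_apply] at h1
    rw [Matrix.mul_apply]
    simp only [Matrix.transpose_apply, Matrix.one_apply]
    rw [show ∑ j, C j k * C j k' = ∑ j, C j k' * C j k from
      Finset.sum_congr rfl fun j _ => mul_comm _ _, h1]
    simp [Pi.single_apply, eq_comm]
  · have := g.map_vadd 0 z
    rw [vadd_eq_add, add_zero, vadd_eq_add] at this
    rw [this, WithLp.toLp_add]
    exact congrArg (· + g 0) (hC z)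

variable {G : SimpleGraph V}

/-- The rigid motion that makes one realization generic makes every other realization generic. -/
theorem exists_isCongruent_isGeneric {p : Configuration V d} (hp : IsGeneric p)
    {x y : FreeCoord e d → ℝ} (hpx : IsCongruent (pin e x) p)
    (hx : ∀ j : Fin d, (j : ℕ) + 1 < d → x (diagCoord e hn j) ≠ 0)
    (hy : ∀ j : Fin d, (j : ℕ) + 1 < d → y (diagCoord e hn j) ≠ 0)
    (hxs : Function.Surjective (pinnedRigidityMap G e x))
    (hyi : Function.Injective (pinnedRigidityMap G e y))
    (hxy : edgeLengths G e (pin e y) = edgeLengths G e (pin e x)) :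
    ∃ r, IsCongruent (pin e y) r ∧ IsGeneric r := by
  obtain ⟨g, hg⟩ := hpx
  refine ⟨fun v => g (pin e y v), ⟨g, fun _ => rfl⟩, isGeneric_of_derive fun t => ?_⟩
  obtain ⟨C, b, hC, hgC⟩ := exists_matrix_isometry g
  have hC' : C * C.transpose = 1 := mul_eq_one_comm.1 hC
  -- To realise the velocity t at g(y) by a derivation, split Cᵀt at y into a rigid part (M, β) and
  -- a pinned part w. Let w' be the pinned velocity at x with the same effect on the lengths, and
  -- choose D with the velocity C(Mx + β + w') on the generic p = g(x).
  obtain ⟨M, hM, β, w, hMw⟩ := exists_eq_affineVelocity_add_pin hn hy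
    fun v => WithLp.toLp 2 (C.transpose.mulVec (t v).ofLp)
  obtain ⟨w', hw'⟩ := hxs (pinnedRigidityMap G e y w)
  obtain ⟨D, hD⟩ := hp.exists_derive_eq fun v => WithLp.toLp 2
    (C.mulVec ((affineVelocity M β (pin e x) + pin e w') v).ofLp)
  let DC : Matrix (Fin d) (Fin d) ℝ := C.map D
  let Db : Fin d → ℝ := fun l => D (b l)
  have hder : ∀ z : EuclideanSpace ℝ (Fin d), (fun l => D (g z l)) =
      DC.mulVec z.ofLp + C.mulVec (fun l => D (z l)) + Db := by
    intro z
    ext l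
    rw [hgC]
    simp only [Matrix.mulVec, dotProduct, Pi.add_apply, map_add, map_sum, Derivation.leibniz,
      smul_eq_mul, DC, Db, Matrix.map_apply, Finset.sum_add_distrib]
    congr 1
    rw [add_comm]
    congr 1
    exact Finset.sum_congr rfl fun k _ => mul_comm _ _
  -- D applied to CᵀC = 1.
  have hskew : ∀ k l, (C.transpose * DC) l k = -(C.transpose * DC) k l := by
    intro k l
    have h1 := congrArg D (congrFun (congrFun hC l) k)
    have h2 : D ((1 : Matrix (Fin d) (Fin d) ℝ) l k) = 0 := by
      rw [Matrix.one_apply]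
      split_ifs <;> simp
    rw [h2, Matrix.mul_apply] at h1
    simp only [Matrix.transpose_apply, map_sum, Derivation.leibniz, smul_eq_mul,
      Finset.sum_add_distrib] at h1
    simp only [Matrix.mul_apply, Matrix.transpose_apply, DC, Matrix.map_apply]
    linarith
  have hsplit : affineVelocity (C.transpose * DC) (C.transpose.mulVec Db) (pin e x) +
      pin e (fun i => D (x i)) = affineVelocity M β (pin e x) + pin e w' := by
    funext v
    have h1 : (fun l => D (p v l)) =
        C.mulVec ((affineVelocity M β (pin e x) + pin e w') v).ofLp :=
      funext fun l => congrArg (fun q : Configuration V d => q v l) hD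
    rw [hg v, hder] at h1
    have h2 := congrArg C.transpose.mulVec h1
    rw [Matrix.mulVec_mulVec, hC, Matrix.one_mulVec, Matrix.mulVec_add, Matrix.mulVec_add,
      Matrix.mulVec_mulVec, Matrix.mulVec_mulVec, hC, Matrix.one_mulVec] at h2
    refine WithLp.ofLp_injective 2 ?_
    rw [← h2, ← derive_pin]
    change _ + _ + _ = _ + _ + _
    rw [add_right_comm]
    rfl
  -- The splitting at x is unique, so D acts on the motion g as (M, β) prescribes, and D x = w'.
  -- Since x and y have equal lengths, D y has the effect of w on them, whence D y = w.
  obtain ⟨h1, h2, h3⟩ := eq_of_affineVelocity_add_pin_eq hn hx hskew hM hsplit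
  have hDy : (fun i => D (y i)) = w := by
    refine hyi ?_
    rw [← hw', ← h3]
    ext E
    have := congrArg D (congrFun hxy E)
    rw [edgeLengths, edgeLengths, derivation_distForm, derivation_distForm, derive_pin,
      derive_pin] at this
    rw [pinnedRigidityMap_apply, pinnedRigidityMap_apply]
    linarith
  refine ⟨D, funext fun v => WithLp.ofLp_injective 2 ?_⟩
  have h4 : (derive D (fun v => g (pin e y v)) v).ofLp = fun l => D (g (pin e y v) l) := rfl
  have h5 : (fun l => D (pin e y v l)) = (pin e w v).ofLp := by
    rw [← hDy, ← derive_pin]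
    rfl
  have h6 : C.mulVec (C.transpose.mulVec (t v).ofLp) = (t v).ofLp := by
    rw [Matrix.mulVec_mulVec, hC', Matrix.one_mulVec]
  have h7 : C.transpose.mulVec (t v).ofLp = M.mulVec (pin e y v).ofLp + β + (pin e w v).ofLp :=
    congrArg WithLp.ofLp (congrFun hMw v)
  have h8 : DC = C * M := by rw [← h1, ← Matrix.mul_assoc, hC', Matrix.one_mul]
  have h9 : Db = C.mulVec β := by rw [← h2, Matrix.mulVec_mulVec, hC', Matrix.one_mulVec]
  rw [h4, hder, h5, h8, h9, ← h6, h7, Matrix.mulVec_add, Matrix.mulVec_add, Matrix.mulVec_mulVec,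
    add_right_comm]

end GenericPosition

/-! ### Parity of the number of realizations. -/

section Parity

variable {V : Type*} [Fintype V] {d n : ℕ} {e : V ≃ Fin n}
  {G : SimpleGraph V} {a : OrientedEdge G e → ℝ}

theorem isArcEnd_edgeLengths (ha : AlgebraicIndependent ℚ a)
    (hcard : Fintype.card (OrientedEdge G e) = Fintype.card (FreeCoord e d)) {o : V}
    (ho : (e o : ℕ) = 0) (hconn : ∀ v, G.Reachable o v) (E₀ : OrientedEdge G e)
    {x : FreeCoord e d → ℝ} (hx : edgeLengths G e (pin e x) = a) :
    IsArcEnd {z : FreeCoord e d → ℝ | (∀ E, E ≠ E₀ → edgeLengths G e (pin e z) E = a E) ∧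
      edgeLengths G e (pin e z) E₀ ≤ a E₀} (fun z => edgeLengths G e (pin e z) E₀) (a E₀) x := by
  classical
  let ε : FreeCoord e d ≃ OrientedEdge G e := (Fintype.equivOfCardEq hcard).symm
  let f : (FreeCoord e d → ℝ) → FreeCoord e d → ℝ := fun z i => edgeLengths G e (pin e z) (ε i)
  have hf : ContDiff ℝ ∞ f := contDiff_pi.2 fun i =>
    contDiff_pi.1 (contDiff_edgeLengths_pin G e) (ε i)
  have hf' : ∀ z w i, fderiv ℝ f z w i = 2 * pinnedRigidityMap G e z w (ε i) := by
    intro z w i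
    have h1 := hasFDerivAt_pi'.1 (hf.differentiable (by simp) z).hasFDerivAt i
    have h2 := hasFDerivAt_pi'.1
      ((contDiff_edgeLengths_pin G e).differentiable (by simp) z).hasFDerivAt (ε i)
    have h3 := congrArg (fun L => L w) (h1.unique h2)
    simp only [ContinuousLinearMap.comp_apply, ContinuousLinearMap.proj_apply,
      fderiv_edgeLengths_pin] at h3
    exact h3
  have hall : ∀ z, (∀ k, k ≠ ε.symm E₀ → f z k = a (ε k)) ↔
      ∀ E, E ≠ E₀ → edgeLengths G e (pin e z) E = a E := by
    intro z
    refine ⟨fun h E hE => ?_, fun h k hk => h _ fun hE => hk (by rw [← hE, ε.symm_apply_apply])⟩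
    have := h (ε.symm E) (fun h => hE (ε.symm.injective h))
    simpa [f] using this
  have hE₀ : ∀ z, f z (ε.symm E₀) = edgeLengths G e (pin e z) E₀ := fun z => by simp [f]
  have hset : {z | (∀ k, k ≠ ε.symm E₀ → f z k = a (ε k)) ∧
      f z (ε.symm E₀) ≤ a (ε (ε.symm E₀))} =
      {z : FreeCoord e d → ℝ | (∀ E, E ≠ E₀ → edgeLengths G e (pin e z) E = a E) ∧
        edgeLengths G e (pin e z) E₀ ≤ a E₀} := by
    ext z
    simp only [mem_ofPred_eq, hall, hE₀, ε.apply_symm_apply]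
  have hclosed : IsClosed {z : FreeCoord e d → ℝ |
      (∀ E, E ≠ E₀ → edgeLengths G e (pin e z) E = a E) ∧
        edgeLengths G e (pin e z) E₀ ≤ a E₀} := by
    have hc := fun E => (continuous_apply E).comp (continuous_edgeLengths_pin (d := d) G e)
    have h : IsClosed {z : FreeCoord e d → ℝ |
        ∀ E, E ≠ E₀ → edgeLengths G e (pin e z) E = a E} := by
      simp only [ofPred_forall]
      exact isClosed_iInter fun E => isClosed_iInter fun _ => isClosed_eq (hc E) continuous_const
    exact h.inter (isClosed_le (hc E₀) continuous_const)
  have hK := isCompact_of_edgeLengths_le (a := a) ho hconn hclosed fun z hz E => by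
    by_cases hE : E = E₀
    · rw [hE]; exact hz.2
    · exact (hz.1 E hE).le
  have := isArcEnd_of_submersion (a := fun i => a (ε i)) (i₀ := ε.symm E₀) hf
    (hset ▸ hK) (x := x) ?_ ?_ (funext fun i => congrFun hx (ε i))
  · rw [hset] at this
    simpa only [hE₀, ε.apply_symm_apply] using this
  -- Away from the fibre only the lengths other than that of `E₀` are known to be independent, which
  -- is all that a regular curve requires.
  · intro z hz _ c
    obtain ⟨D, hD⟩ := exists_derivation_pinnedRigidityMap ha ((hall z).1 hz)
      fun E => c (ε.symm E) / 2
    refine ⟨fun i => D (z i), fun k hk => ?_⟩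
    rw [hf', hD _ fun h => hk (by rw [← h, ε.symm_apply_apply]), ε.symm_apply_apply]
    ring
  · intro z hz w w' hw
    refine pinnedRigidityMap_injective ha hcard (x := z) (funext fun E => ?_) (funext fun E => ?_)
    · simpa [f] using congrFun hz (ε.symm E)
    · have := congrFun hw (ε.symm E)
      rw [hf', hf', ε.apply_symm_apply] at this
      linarith

/-- Pinned representatives can be chosen with nonnegative diagonal, and on the fibre the diagonal
entries other than the last are nonzero. The last sign is left free for the reflection to act on. -/
theorem realizations_eq_image (hn : d + 2 ≤ n) {p : Configuration V d}
    (hp : edgeLengths G e p = a) (hdiag : ∀ x : FreeCoord e d → ℝ, edgeLengths G e (pin e x) = a →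
      ∀ j : Fin d, (j : ℕ) + 1 < d → x (diagCoord e hn j) ≠ 0) :
    realizations G p = (fun x : FreeCoord e d → ℝ => Quotient.mk (congruence V d) (pin e x)) ''
      {x | edgeLengths G e (pin e x) = a ∧
        ∀ j : Fin d, (j : ℕ) + 1 < d → 0 < x (diagCoord e hn j)} := by
  ext c
  constructor
  · rintro ⟨q, hq, rfl⟩
    obtain ⟨x, hx, hx0⟩ := exists_isCongruent_pin e hn q
    have hxa : edgeLengths G e (pin e x) = a := by
      rw [hx.edgeLengths_eq, ← hp]
      exact (isEquivalent_iff G e).1 hq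
    exact ⟨x, ⟨hxa, fun j hj => lt_of_le_of_ne (hx0 j) (hdiag x hxa j hj).symm⟩,
      Quotient.sound (s := congruence V d) hx.symm⟩
  · rintro ⟨x, hx, rfl⟩
    exact ⟨pin e x, (isEquivalent_iff G e).2 (hx.1.trans hp.symm), rfl⟩

theorem even_ncard_realizations (hd : 1 ≤ d) (hn : d + 2 ≤ n) (ha : AlgebraicIndependent ℚ a)
    (hcard : Fintype.card (OrientedEdge G e) = Fintype.card (FreeCoord e d)) {o : V}
    (ho : (e o : ℕ) = 0) (hconn : ∀ v, G.Reachable o v) {p : Configuration V d}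
    (hp : edgeLengths G e p = a) :
    (realizations G p).Finite ∧ Even (realizations G p).ncard := by
  classical
  obtain ⟨E₀⟩ : Nonempty (OrientedEdge G e) := by
    rw [← Fintype.card_pos_iff, hcard, Fintype.card_pos_iff]
    exact ⟨diagCoord e hn ⟨0, hd⟩⟩
  have hdiag : ∀ x : FreeCoord e d → ℝ, (∀ E, E ≠ E₀ → edgeLengths G e (pin e x) E = a E) →
      ∀ j : Fin d, (j : ℕ) + 1 < d → x (diagCoord e hn j) ≠ 0 := fun x hx j hj =>
    diagCoord_ne_zero ha hcard hx hn hj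
  have hreal := realizations_eq_image hn hp fun x hx => hdiag x fun E _ => congrFun hx E
  have hfin : (realizations G p).Finite := by
    rw [hreal]
    exact ((finite_setOf_edgeLengths_eq ha hcard ho hconn).subset fun x hx => hx.1).image _
  refine ⟨hfin, ?_⟩
  let K := {z : FreeCoord e d → ℝ | (∀ E, E ≠ E₀ → edgeLengths G e (pin e z) E = a E) ∧
      edgeLengths G e (pin e z) E₀ ≤ a E₀}
  let P := {z : FreeCoord e d → ℝ | ∀ j : Fin d, (j : ℕ) + 1 < d → 0 < z (diagCoord e hn j)}
  have hset : {x : FreeCoord e d → ℝ | edgeLengths G e (pin e x) = a ∧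
      ∀ j : Fin d, (j : ℕ) + 1 < d → 0 < x (diagCoord e hn j)} =
      {x ∈ K | edgeLengths G e (pin e x) E₀ = a E₀ ∧ x ∈ P} := by
    ext x
    constructor
    · rintro ⟨h1, h2⟩
      exact ⟨⟨fun E _ => congrFun h1 E, (congrFun h1 E₀).le⟩, congrFun h1 E₀, h2⟩
    · rintro ⟨h1, h2, h3⟩
      refine ⟨funext fun E => ?_, h3⟩
      by_cases hE : E = E₀
      · rw [hE, h2]
      · exact h1.1 E hE
  have hlen : ∀ x ∈ K, edgeLengths G e (pin e x) E₀ = a E₀ → edgeLengths G e (pin e x) = a :=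
    fun x hx h => funext fun E => by
      by_cases hE : E = E₀
      · rw [hE, h]
      · exact hx.1 E hE
  have hrefl : ∀ x : FreeCoord e d → ℝ,
      edgeLengths G e (pin e (reflect e x)) = edgeLengths G e (pin e x) := fun x =>
    funext fun E => distForm_pin_reflect e x _ _
  rw [hreal, hset]
  rw [hreal, hset] at hfin
  refine even_ncard_of_isArcEnd (h := fun x => edgeLengths G e (pin e x) E₀)
    (fun x hx hxc => isArcEnd_edgeLengths ha hcard ho hconn E₀ (hlen x hx hxc))
    (continuous_reflect e) (reflect_reflect e)
    (fun x hx => ⟨fun E hE => (congrFun (hrefl x) E).trans (hx.1 E hE),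
      (congrFun (hrefl x) E₀).le.trans hx.2⟩)
    (fun x => congrFun (hrefl x) E₀)
    (fun x hx => reflect_ne_self ha hcard hx.1 hd hn) ?_ _ ?_ ?_ hfin
  -- A diagonal coordinate changing sign on a component would vanish somewhere on it, against
  -- `diagCoord_ne_zero`.
  · intro x hx hxP z hz j hj
    by_contra! hle
    obtain ⟨y, hy, hy0⟩ := isPreconnected_connectedComponentIn.intermediate_value
      (f := fun y : FreeCoord e d → ℝ => y (diagCoord e hn j)) hz (mem_connectedComponentIn hx)
      (continuous_apply _).continuousOn ⟨hle, (hxP j hj).le⟩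
    exact hdiag y (connectedComponentIn_subset K x hy).1 j hj hy0
  · intro x hx j hj
    rw [reflect, if_neg (by simp only [diagCoord]; omega)]
    exact hx j hj
  · intro x hx hxc hxP y hy hyc hyP
    rw [Quotient.eq (r := congruence V d)]
    change IsCongruent (pin e x) (pin e y) ↔ _
    rw [isCongruent_iff]
    refine ⟨fun h => eq_or_eq_reflect e hn hd h fun j hj => mul_pos (hxP j hj) (hyP j hj), ?_⟩
    rintro (rfl | rfl) u v
    · rfl
    · exact distForm_pin_reflect e x u v

end Parity

end Framework

theorem theorem1 {V : Type*} [Fintype V] {d : ℕ} (hd : 1 ≤ d) (hV : d + 2 ≤ Fintype.card V)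
    (G : SimpleGraph V) (p : Framework.Configuration V d)
    (hgen : Framework.IsGeneric p) (hiso : Framework.IsIsostatic G p) :
    ¬ Framework.IsGloballyRigid G p ∧
    ((Framework.realizations G p).Finite ∧ Even (Framework.realizations G p).ncard) ∧
    (∀ q : Framework.Configuration V d, Framework.IsEquivalent G p q →
      Framework.IsLocallyRigid G q ∧ Framework.IsInfinitesimallyRigid G q ∧
      ∃ r : Framework.Configuration V d, Framework.IsCongruent q r ∧ Framework.IsGeneric r) ∧
    (∀ q : Framework.Configuration V d, Framework.IsGeneric q →
      Framework.IsLocallyRigid G q) := by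
  open Framework in
  let e : V ≃ Fin (Fintype.card V) := Fintype.equivFin V
  have ha := hgen.algebraicIndependent_edgeLengths (e := e) hiso.2
  have hcard := hiso.card_eq (e := e) hd hV hgen
  obtain ⟨x, hx, -⟩ := exists_isCongruent_pin e hV p
  have ho : (e (e.symm ⟨0, by omega⟩) : ℕ) = 0 := by simp
  have hxa := hx.edgeLengths_eq G e
  have hconn := reachable_of_pinnedRigidityMap_injective hd
    (pinnedRigidityMap_injective ha hcard hxa) ho
  have hE₀ : Nonempty (OrientedEdge G e) := by
    rw [← Fintype.card_pos_iff, hcard, Fintype.card_pos_iff]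
    exact ⟨diagCoord e hV ⟨0, hd⟩⟩
  have hdiag : ∀ y : FreeCoord e d → ℝ, edgeLengths G e (pin e y) = edgeLengths G e p →
      ∀ j : Fin d, (j : ℕ) + 1 < d → y (diagCoord e hV j) ≠ 0 := fun y hy j hj =>
    diagCoord_ne_zero (E₀ := hE₀.some) ha hcard (fun E _ => congrFun hy E) hV hj
  obtain ⟨hfin, heven⟩ := even_ncard_realizations hd hV ha hcard ho hconn rfl
  refine ⟨fun hglob => ?_, ⟨hfin, heven⟩, fun q hq => ?_, fun q hq => ?_⟩
  · have : realizations G p = {Quotient.mk (congruence V d) p} := by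
      refine Set.eq_singleton_iff_unique_mem.2 ⟨⟨p, fun _ _ _ => rfl, rfl⟩, ?_⟩
      rintro _ ⟨q, hq, rfl⟩
      exact Quotient.sound (s := congruence V d) (hglob q hq).symm
    rw [this, Set.ncard_singleton] at heven
    exact absurd heven (by decide)
  · obtain ⟨y, hy, -⟩ := exists_isCongruent_pin e hV q
    have hqa : edgeLengths G e q = edgeLengths G e p := (isEquivalent_iff G e).1 hq
    have hya := (hy.edgeLengths_eq G e).trans hqa
    have hyi := pinnedRigidityMap_injective ha hcard hya
    obtain ⟨r, hr, hrg⟩ := exists_isCongruent_isGeneric hV hgen hx.symm (hdiag x hxa) (hdiag y hya)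
      (pinnedRigidityMap_surjective ha hxa) hyi (hya.trans hxa.symm)
    exact ⟨isLocallyRigid_of_edgeLengths_eq ha hcard ho hconn hV hqa,
      hy.symm.isInfinitesimallyRigid (isInfinitesimallyRigid_pin hV (hdiag y hya) hyi),
      r, hy.trans hr, hrg⟩
  -- The edge count and connectedness concern the graph alone, so independence of the lengths of q
  -- is enough.
  · exact isLocallyRigid_of_edgeLengths_eq (hgen.algebraicIndependent_edgeLengths_of hq ha) hcard
      ho hconn hV rfl
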